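/- Let $D$ be a finite non-empty set of decisions, let $\theta$ be a random parameter with a given prior law, and let $f_d(\theta)$, $d\in D$, be the (measurable) net benefits. Let $Y$ be a random vector in a real normed space which, given $\theta$, has conditional density $\rho(y\,|\,\theta)$ with respect to a $\sigma$-finite reference measure (for instance $Y=h(\theta)+\text{noise}$ with noise density $\rho$ and $\rho(y\,|\,\theta)=\rho(y-h(\theta))$). Write $\mathbb{E}_\theta$ for expectation under the prior, $\mathbb{P}_Y,\mathbb{E}_Y$ for probability and expectation under the marginal law of $Y$, and \[ \rho(y)=\mathbb{E}_\theta[\rho(y\,|\,\theta)],\qquad G_d(y)=\mathbb{E}_\theta\!\left[f_d(\theta)\frac{\rho(y\,|\,\theta)}{\rho(y)}\right], \] so that $G_d(Y)$ is the posterior mean of $f_d(\theta)$ given $Y$. Let \[ \mathrm{EVPI}=\mathbb{E}_\theta\big[\max_d f_d(\theta)\big]-\max_d\mathbb{E}_\theta[f_d(\theta)],\qquad \mathrm{EVSI}=\mathbb{E}_Y\big[\max_d G_d(Y)\big]-\max_d\mathbb{E}_\theta[f_d(\theta)]. \] Let $K$ be the set of all $y$ with $\rho(y)>0$ at which the maximizer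 $d_{\mathrm{opt}}(y)$ of $d\mapsto G_d(y)$ is not unique, and let $\mathrm{dist}(y,K)=\inf_{z\in K}\|y-z\|$ ($=\infty$ if $K=\emptyset$). Assume: 1. there is $0<F_{max}<\infty$ with $|f_d(\theta)|\le F_{max}$ for all $d$ and $\theta$; 2. there is $c_0>0$ with $\mathbb{P}_Y[\mathrm{dist}(Y,K)\le\epsilon]\le c_0\epsilon$ for all $0<\epsilon<1$; 3. there are $c_1,c_2>0$ such that, almost surely, if $Y\notin K$, then $G_{d_{\mathrm{opt}}(Y)}(Y)-G_d(Y)>\min(c_1,c_2\,\mathrm{dist}(Y,K))$ for every $d\neq d_{\mathrm{opt}}(Y)$; 4. $p\ge2$ is such that $\mathbb{E}_Y\big[\mathbb{E}_\theta\big[(\rho(Y\,|\,\theta)/\rho(Y))^p\big]\big]<\infty$. Let $M_0\ge1$ be an integer and let $\theta_0,\theta_1,\ldots$ be i.i.d. from the prior and independent of $Y$. For a finite non-empty block $I$ of indices let \[ P(I)=\frac{\sum_{i\in I}\max_d f_d(\theta_i)\,\rho(Y\,|\,\theta_i)}{\sum_{i\in I}\rho(Y\,|\,\theta_i)}-\max_{d}\frac{\sum_{i\in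 I} f_d(\theta_i)\,\rho(Y\,|\,\theta_i)}{\sum_{i\in I}\rho(Y\,|\,\theta_i)}\qquad (0/0:=0). \] Let $\Delta P_0=P(\{0,\ldots,M_0-1\})$ and, for $\ell\ge1$, let \[ \Delta P_\ell=P(I_\ell)-\tfrac12\big(P(I_\ell^{(a)})+P(I_\ell^{(b)})\big), \] where $I_\ell=\{0,\ldots,M_02^\ell-1\}$, and $I_\ell^{(a)}$, $I_\ell^{(b)}$ are its first and second halves. Then each $\Delta P_\ell$ is square integrable, and as $\ell\to\infty$ \[ \mathbb{V}[\Delta P_\ell]=O\big(2^{-(3p/(2p+2))\ell}\big)\quad\text{and}\quad \mathbb{E}[|\Delta P_\ell|]=O\big(2^{-(p/(p+1))\ell}\big). \] Moreover, let $p>2$, and let one sample of $\Delta P_\ell$ cost one draw of $Y$ and, for each of the $M_02^\ell$ inner samples, one draw of $\theta$, one evaluation of the likelihood and one evaluation of each $f_d$, where each of these operations has a fixed cost. Then there is a constant $c_4>0$ such that for every $0<\varepsilon<e^{-1}$ there are $L\ge 0$ and $N_0,\ldots,N_L\ge1$ for which the multilevel estimator $Z=\sum_{\ell=0}^L\frac1{N_\ell}\sum_{n=1}^{N_\ell}\Delta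 P_\ell^{(n)}$, built from independent samples $\Delta P_\ell^{(n)}$ of $\Delta P_\ell$, satisfies \[ \mathbb{E}\big[(Z-(\mathrm{EVPI}-\mathrm{EVSI}))^2\big]\le\varepsilon^2 \] at a total cost of at most $c_4\,\varepsilon^{-2}$. -/

import Mathlib

open MeasureTheory ProbabilityTheory Filter Asymptotics

noncomputable section

/-- A decision problem with sample information: a prior law of the uncertain parameter `θ : Θ`,
the net benefits `f d θ` of the decisions `d : D`, and the conditional probability density
`lik θ y` (the likelihood `ρ(y | θ)`) of the information `Y : E` given `θ`, with respect to a
reference measure `ref` (Lebesgue measure in the case of `Y = h θ + noise` with noise density `ρ`,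
where `lik θ y = ρ (y - h θ)`). -/
structure DecisionModel (D Θ E : Type*) [MeasurableSpace Θ] [MeasurableSpace E] where
  prior : Measure Θ
  prior_prob : IsProbabilityMeasure prior
  f : D → Θ → ℝ
  f_meas : ∀ d, Measurable (f d)
  ref : Measure E
  ref_sigmaFinite : SigmaFinite ref
  lik : Θ → E → ℝ
  lik_nonneg : ∀ θ y, 0 ≤ lik θ y
  lik_meas : Measurable (Function.uncurry lik)
  lik_mass : ∀ θ, ∫⁻ y, ENNReal.ofReal (lik θ y) ∂ref = 1

attribute [instance] DecisionModel.prior_prob DecisionModel.ref_sigmaFinite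

namespace DecisionModel

section Model

variable {D Θ E : Type*} [MeasurableSpace Θ] [MeasurableSpace E] (M : DecisionModel D Θ E)

/-- The joint law of `(θ, Y)`: `θ` follows the prior, and `Y` has density `lik θ` given `θ`. -/
def jointLaw : Measure (Θ × E) :=
  (M.prior.prod M.ref).withDensity fun z => ENNReal.ofReal (M.lik z.1 z.2)

/-- The law of the information `Y`. -/
def lawY : Measure E := M.jointLaw.snd

/-- `ρ(y) = 𝔼_θ[ρ(y | θ)]`, the marginal density of `Y`. -/
def marg (y : E) : ℝ := ∫ θ, M.lik θ y ∂M.prior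

/-- The posterior density of `θ` given `Y = y` relative to the prior, by Bayes' theorem. -/
def posteriorDensity (y : E) (θ : Θ) : ℝ := M.lik θ y / M.marg y

/-- `G_d(y) = 𝔼_{θ | Y = y}[f_d(θ)]`, the posterior mean of the net benefit of `d`. -/
def G (d : D) (y : E) : ℝ := ∫ θ, M.f d θ * M.posteriorDensity y θ ∂M.prior

/-- `d` is an optimal decision after observing `y`. -/
def IsOptimal (d : D) (y : E) : Prop := ∀ e, M.G e y ≤ M.G d y

/-- The decision manifold `K`: the points of the domain of `Y` (where the marginal density is
positive, so that the posterior exists) at which the optimal decision is not unique. -/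
def K : Set E := {y | 0 < M.marg y ∧ ¬ ∃! d, M.IsOptimal d y}

/-- Bounded net benefits. -/
def BoundedBenefit : Prop := ∃ Fmax : ℝ, 0 < Fmax ∧ ∀ d θ, |M.f d θ| ≤ Fmax

/-- `ℙ[dist(Y, K) ≤ ε] ≤ c₀ ε` for all `0 < ε < 1`. The distance to an empty
set is `∞`. -/
def ManifoldProbBound [PseudoEMetricSpace E] : Prop :=
  ∃ c₀ : ℝ, 0 < c₀ ∧ ∀ ε : ℝ, 0 < ε → ε < 1 →
    M.lawY {y | Metric.infEDist y M.K ≤ ENNReal.ofReal ε} ≤ ENNReal.ofReal (c₀ * ε)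

/-- Linear separation: almost surely, if `Y ∉ K`, then the optimal decision beats every other one
by more than `min (c₁, c₂ dist(Y, K))`. -/
def LinearSeparation [PseudoEMetricSpace E] : Prop :=
  ∃ c₁ c₂ : ℝ, 0 < c₁ ∧ 0 < c₂ ∧ ∀ᵐ y ∂M.lawY, y ∉ M.K →
    ∀ dopt, M.IsOptimal dopt y → ∀ d, d ≠ dopt →
      min (ENNReal.ofReal c₁) (ENNReal.ofReal c₂ * Metric.infEDist y M.K)
        < ENNReal.ofReal (M.G dopt y - M.G d y)

/-- Finite `p`-th moment of the likelihood ratio: `𝔼_Y 𝔼_θ[(ρ(Y | θ) / ρ(Y))^p] < ∞`, where `θ`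
follows the prior and is independent of `Y`. -/
def LikelihoodRatioMoment (p : ℝ) : Prop :=
  ∫⁻ y, ∫⁻ θ, ENNReal.ofReal ((M.lik θ y / M.marg y) ^ p) ∂M.prior ∂M.lawY < ⊤

variable [Fintype D] [Nonempty D]

/-- The maximum of finitely many reals. -/
def maxD (a : D → ℝ) : ℝ := Finset.univ.sup' Finset.univ_nonempty a

/-- The expected value of perfect information. -/
def EVPI : ℝ :=
  ∫ θ, maxD (fun d => M.f d θ) ∂M.prior - maxD fun d => ∫ θ, M.f d θ ∂M.prior

/-- The expected value of sample information. -/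
def EVSI : ℝ :=
  ∫ y, maxD (fun d => M.G d y) ∂M.lawY - maxD fun d => ∫ θ, M.f d θ ∂M.prior

/-- The average of `g` over the `m` samples `t a, …, t (a + m - 1)`. -/
def avg (g : Θ → ℝ) (t : ℕ → Θ) (a m : ℕ) : ℝ := (∑ i ∈ Finset.range m, g (t (a + i))) / m

/-- The ratio estimator computed from `y` and the samples `t a, …, t (a + m - 1)` of `θ`, the same
samples being used in all averages. (A ratio whose denominator vanishes has a vanishing numerator,
and is given the value `0`.) -/
def ratioEst (a m : ℕ) (x : E × (ℕ → Θ)) : ℝ :=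
  avg (fun θ => maxD (fun d => M.f d θ) * M.lik θ x.1) x.2 a m
      / avg (fun θ => M.lik θ x.1) x.2 a m
    - maxD fun d => avg (fun θ => M.f d θ * M.lik θ x.1) x.2 a m
      / avg (fun θ => M.lik θ x.1) x.2 a m

/-- The antithetic correction `ΔP_ℓ` as a function of a sample `(Y, (θ_i)_i)`, of which it uses
`Y` and the first `M₀ 2^ℓ` of the `θ_i`. -/
def deltaP (M₀ : ℕ) : ℕ → E × (ℕ → Θ) → ℝ
  | 0, x => M.ratioEst 0 M₀ x
  | ℓ + 1, x => M.ratioEst 0 (M₀ * 2 ^ (ℓ + 1)) x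
      - (M.ratioEst 0 (M₀ * 2 ^ ℓ) x + M.ratioEst (M₀ * 2 ^ ℓ) (M₀ * 2 ^ ℓ) x) / 2

/-- `X ℓ n` is the `n`-th sample for level `ℓ`: it consists of a copy of `Y` and of i.i.d. copies
`θ_0, θ_1, …` from the prior, independent of that copy of `Y`. All the samples are independent. -/
structure IsSampling {Ω : Type*} [MeasurableSpace Ω] (μ : Measure Ω)
    (X : ℕ → ℕ → Ω → E × (ℕ → Θ)) : Prop where
  meas : ∀ ℓ n, Measurable (X ℓ n)
  law : ∀ ℓ n, μ.map (X ℓ n) = M.lawY.prod (Measure.infinitePi fun _ => M.prior)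
  indep : iIndepFun (fun k : ℕ × ℕ => X k.1 k.2) μ

/-- The multilevel Monte Carlo estimator with top level `L` and `N ℓ` samples on level `ℓ`. -/
def mlmc {Ω : Type*} (M₀ : ℕ) (X : ℕ → ℕ → Ω → E × (ℕ → Θ)) (L : ℕ) (N : ℕ → ℕ) (ω : Ω) : ℝ :=
  ∑ ℓ ∈ Finset.range (L + 1), (∑ n ∈ Finset.range (N ℓ), M.deltaP M₀ ℓ (X ℓ n ω)) / N ℓ

/-- The cost of one sample of `ΔP_ℓ`: one draw of `Y`, and for each of the `M₀ 2^ℓ` inner samples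
one draw of `θ`, one evaluation of the likelihood and one evaluation of each net benefit. The
arguments are the costs of these operations. -/
def sampleCost (D : Type*) [Fintype D] (costY costθ costLik costF : NNReal) (M₀ ℓ : ℕ) : ℝ :=
  costY + (M₀ * 2 ^ ℓ : ℕ) * (costθ + costLik + Fintype.card D * costF)

/-- The total cost of the multilevel estimator. -/
def mlmcCost (D : Type*) [Fintype D] (costY costθ costLik costF : NNReal) (M₀ L : ℕ)
    (N : ℕ → ℕ) : ℝ :=
  ∑ ℓ ∈ Finset.range (L + 1), N ℓ * sampleCost D costY costθ costLik costF M₀ ℓ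

end Model

end DecisionModel

end

/-! Dividing numerator and denominator by the marginal density turns each ratio in the estimator
into A / B, where B averages the likelihood ratio and has conditional mean 1, and A averages f times
the likelihood ratio and has conditional mean G. Let w be the sum of the deviations |B - 1| and |A -
G B| over both half blocks (`levelDev`). Conditionally on Y these are averages of i.i.d. centred
variables, so a Marcinkiewicz-Zygmund inequality and the moment hypothesis give E[w^p] = O(m^(-p/2))
for half blocks of m samples (`exists_integral_levelDev_rpow_le`).

For w ≤ 1/2 the antithetic correction is always O(w). It is O(w^2) once the optimal decision leads
by more than 4w, because the same decision then attains the maximum in the full block and in both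
halves, and the difference of ratios factors into two terms of size O(w) (`abs_antithetic_le`,
`abs_antithetic_le_sq`). Fix a scale ε and 1 ≤ q ≤ 2. The event that w is at least a multiple of ε
contributes O(ε^(q-p) w^p) to |ΔP|^q; points within ε of K contribute ε^q on an event of probability
O(ε); elsewhere linear separation supplies the gap and the contribution is ε^(2q) ≤ ε^(q+1).
Balancing ε^(q+1) against ε^(q-p) 2^(-pℓ/2) gives ε = 2^(-pℓ/(2p+2)), and q = 2 and q = 1 yield the
two rates (`exists_integral_abs_deltaP_rpow_le`).

For the complexity bound, the expectations telescope because both halves have the law of the block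
one level below, and the bias at the top level is O(2^(-L/2))
(`exists_abs_integral_ratioEst_sub_le`). This weak rate suffices: bias ε needs 2^L of order ε^(-2),
so even one sample on each level costs only O(ε^(-2)). The variance exponent 3p/(2p+2) exceeds the
cost exponent 1 exactly when p > 2, which makes the remaining cost a geometric series
(`exists_multilevel_allocation`). -/

/-! ### Moments of sums of independent centred variables. -/

/-- Compare with exp (p u): Taylor's formula covers |p u| ≤ 1, and beyond that the quadratic term
alone is large enough. -/
lemma one_add_rpow_le_quadratic {p u : ℝ} (hp : 0 ≤ p) (hu : |u| ≤ 1 / 2) :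
    (1 + u) ^ p ≤ 1 + p * u + Real.exp p * (p * u) ^ 2 := by
  have hu' := abs_le.1 hu
  have h1 : (1 + u) ^ p ≤ Real.exp (p * u) := by
    have h : (1 + u) ≤ Real.exp u := by linarith [Real.add_one_le_exp u]
    calc (1 + u) ^ p ≤ (Real.exp u) ^ p := Real.rpow_le_rpow (by linarith) h hp
      _ = Real.exp (p * u) := by rw [← Real.exp_mul, mul_comm]
  have hexp1 : 1 ≤ Real.exp p := Real.one_le_exp hp
  refine h1.trans ?_
  set v := p * u with hv
  have hvp : v ≤ p := by nlinarith
  rcases le_total |v| 1 with h | h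
  · have := (abs_le.1 (Real.abs_exp_sub_one_sub_id_le h)).2
    nlinarith [mul_le_mul_of_nonneg_right hexp1 (sq_nonneg v)]
  · have hv2 : 1 ≤ v ^ 2 := by
      rw [← sq_abs]; nlinarith [abs_nonneg v]
    rcases le_total 0 v with h0 | h0
    · have : Real.exp v ≤ Real.exp p := Real.exp_le_exp.2 hvp
      nlinarith [mul_le_mul_of_nonneg_left hv2 (Real.exp_pos p).le]
    · have h3 : Real.exp v ≤ 1 := Real.exp_le_one_iff.2 h0
      rw [abs_of_nonpos h0] at h
      nlinarith [mul_le_mul_of_nonneg_right hexp1 (sq_nonneg v)]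

lemma abs_rpow_eq_mul_sq {p x : ℝ} (hx : x ≠ 0) : |x| ^ p = |x| ^ (p - 2) * x ^ 2 := by
  rw [← sq_abs x, ← Real.rpow_natCast |x| 2, ← Real.rpow_add (abs_pos.2 hx)]
  norm_num

/-- If |x| ≤ 2|h|, every term is comparable with |h|^p; otherwise factor out |x|^p and expand in u =
h / x. The linear term is kept exactly, since it integrates to zero for independent centred
increments. -/
lemma exists_abs_add_rpow_le {p : ℝ} (hp : 2 ≤ p) :
    ∃ C : ℝ, 1 ≤ C ∧ ∀ x h : ℝ, |x + h| ^ p ≤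
      |x| ^ p + p * (|x| ^ (p - 2) * x) * h + C * (|x| ^ (p - 2) * h ^ 2 + |h| ^ p) := by
  have hexp1 : 1 ≤ Real.exp p := Real.one_le_exp (by linarith)
  have hA : 0 ≤ (3 : ℝ) ^ p := by positivity
  have hB : 0 ≤ p * 2 ^ (p - 1) := by positivity
  have hC : 0 ≤ Real.exp p * p ^ 2 := by positivity
  refine ⟨1 + (3 : ℝ) ^ p + p * 2 ^ (p - 1) + Real.exp p * p ^ 2, by linarith, fun x h => ?_⟩
  set C := 1 + (3 : ℝ) ^ p + p * 2 ^ (p - 1) + Real.exp p * p ^ 2 with hCdef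
  have hx0 : 0 ≤ |x| ^ p := by positivity
  have hh0 : 0 ≤ |h| ^ p := by positivity
  have hxh0 : 0 ≤ |x| ^ (p - 2) * h ^ 2 := by positivity
  rcases le_or_gt (|x|) (2 * |h|) with hc | hc
  · have h1 : |x + h| ^ p ≤ 3 ^ p * |h| ^ p := by
      rw [← Real.mul_rpow (by norm_num) (abs_nonneg h)]
      refine Real.rpow_le_rpow (abs_nonneg _) ?_ (by linarith)
      linarith [abs_add_le x h]
    have h2 : -(p * (|x| ^ (p - 2) * x) * h) ≤ p * 2 ^ (p - 1) * |h| ^ p := by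
      have e1 : |p * (|x| ^ (p - 2) * x) * h| ≤ p * 2 ^ (p - 1) * |h| ^ p := by
        have e2 : |p * (|x| ^ (p - 2) * x) * h| = p * ((|x| ^ (p - 2) * |x|) * |h|) := by
          rw [abs_mul, abs_mul, abs_mul, abs_of_nonneg (by linarith : 0 ≤ p),
            abs_of_nonneg (by positivity : 0 ≤ |x| ^ (p - 2))]
          ring
        rw [e2]
        rcases eq_or_ne x 0 with rfl | hx
        · simp; positivity
        have hh : 0 < |h| := by
          have := abs_pos.2 hx
          linarith
        have e3 : |x| ^ (p - 2) * |x| = |x| ^ (p - 1) := by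
          nth_rewrite 2 [← Real.rpow_one |x|]
          rw [← Real.rpow_add (abs_pos.2 hx)]; ring_nf
        have e4 : |h| ^ p = |h| ^ (p - 1) * |h| := by
          nth_rewrite 3 [← Real.rpow_one |h|]
          rw [← Real.rpow_add hh]; ring_nf
        have e5 : |x| ^ (p - 1) ≤ 2 ^ (p - 1) * |h| ^ (p - 1) := by
          rw [← Real.mul_rpow (by norm_num) (abs_nonneg h)]
          exact Real.rpow_le_rpow (abs_nonneg _) hc (by linarith)
        rw [e3, e4]
        have e6 := mul_le_mul_of_nonneg_right e5 hh.le
        have e7 := mul_le_mul_of_nonneg_left e6 (by linarith : 0 ≤ p)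
        linarith
      exact (neg_le_abs _).trans e1
    have h3 : (3 ^ p + p * 2 ^ (p - 1)) * |h| ^ p ≤ C * |h| ^ p :=
      mul_le_mul_of_nonneg_right (by linarith) hh0
    have h4 : 0 ≤ C * (|x| ^ (p - 2) * h ^ 2) := mul_nonneg (by linarith) hxh0
    linarith
  · have hx : x ≠ 0 := by
      rintro rfl
      simp at hc
      linarith [abs_nonneg h]
    have hu : |h / x| ≤ 1 / 2 := by
      rw [abs_div, div_le_iff₀ (abs_pos.2 hx)]; linarith
    have hu' := abs_le.1 hu
    have h1 : |x + h| ^ p = |x| ^ p * (1 + h / x) ^ p := by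
      rw [← Real.mul_rpow (abs_nonneg x) (by linarith)]
      congr 1
      rw [← abs_of_nonneg (by linarith : 0 ≤ 1 + h / x), ← abs_mul]
      congr 1
      field_simp
    have h2 := mul_le_mul_of_nonneg_left (one_add_rpow_le_quadratic (p := p) (by linarith) hu) hx0
    rw [← h1] at h2
    have h3 : |x| ^ p * (1 + p * (h / x) + Real.exp p * (p * (h / x)) ^ 2)
        = |x| ^ p + p * (|x| ^ (p - 2) * x) * h
          + Real.exp p * p ^ 2 * (|x| ^ (p - 2) * h ^ 2) := by
      rw [abs_rpow_eq_mul_sq hx]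
      field_simp
    have h4 : Real.exp p * p ^ 2 * (|x| ^ (p - 2) * h ^ 2) ≤ C * (|x| ^ (p - 2) * h ^ 2) :=
      mul_le_mul_of_nonneg_right (by linarith) hxh0
    have h5 : 0 ≤ C * |h| ^ p := mul_nonneg (by linarith) hh0
    linarith

/-- A weighted Young inequality, proved by deciding which of h^2 and κ x^2 is larger. -/
lemma abs_rpow_mul_sq_le {p κ : ℝ} (hp : 2 ≤ p) (hκ : 0 < κ) (x h : ℝ) :
    |x| ^ (p - 2) * h ^ 2 ≤ κ * |x| ^ p + κ⁻¹ ^ (p / 2 - 1) * |h| ^ p := by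
  have hx0 : 0 ≤ |x| ^ p := by positivity
  have hh0 : 0 ≤ κ⁻¹ ^ (p / 2 - 1) * |h| ^ p := by positivity
  rcases eq_or_ne h 0 with rfl | hh
  · simp only [ne_eq, OfNat.ofNat_ne_zero, not_false_eq_true, zero_pow, mul_zero]
    positivity
  rcases eq_or_ne x 0 with rfl | hx
  · rcases eq_or_lt_of_le hp with rfl | hp'
    · simp
    · rw [abs_zero, Real.zero_rpow (by linarith), zero_mul]
      positivity
  rcases le_total (h ^ 2) (κ * x ^ 2) with hc | hc
  · have : |x| ^ (p - 2) * h ^ 2 ≤ κ * |x| ^ p := by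
      rw [abs_rpow_eq_mul_sq (p := p) hx]
      have := mul_le_mul_of_nonneg_left hc (by positivity : 0 ≤ |x| ^ (p - 2))
      linarith
    linarith
  · have h1 : |x| ^ (p - 2) ≤ κ⁻¹ ^ (p / 2 - 1) * |h| ^ (p - 2) := by
      have e : ∀ z : ℝ, |z| ^ (p - 2) = (z ^ 2) ^ (p / 2 - 1) := fun z => by
        rw [← sq_abs z, ← Real.rpow_natCast |z| 2, ← Real.rpow_mul (abs_nonneg z)]
        congr 1; push_cast; ring
      rw [e, e, ← Real.mul_rpow (by positivity) (by positivity)]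
      refine Real.rpow_le_rpow (by positivity) ?_ (by linarith)
      rw [inv_mul_eq_div, le_div_iff₀ hκ]; linarith
    have : |x| ^ (p - 2) * h ^ 2 ≤ κ⁻¹ ^ (p / 2 - 1) * |h| ^ p := by
      rw [abs_rpow_eq_mul_sq hh, ← mul_assoc]
      exact mul_le_mul_of_nonneg_right h1 (sq_nonneg h)
    have : 0 ≤ κ * |x| ^ p := by positivity
    linarith

/-- Young's inequality with κ of order 1 / n trades the mixed term for a factor 1 + 1 / (2n), mild
enough to be iterated n times at the growth rate n^(p/2). -/
lemma exists_abs_add_rpow_le_nat {p : ℝ} (hp : 2 ≤ p) :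
    ∃ C : ℝ, 1 ≤ C ∧ ∀ (n : ℕ) (x h : ℝ), 0 < n → |x + h| ^ p ≤
      (1 + 1 / (2 * n)) * |x| ^ p + p * (|x| ^ (p - 2) * x) * h
        + C * (n : ℝ) ^ (p / 2 - 1) * |h| ^ p := by
  obtain ⟨C, hC, H⟩ := exists_abs_add_rpow_le hp
  refine ⟨C * ((2 * C) ^ (p / 2 - 1) + 1), ?_, fun n x h hn => ?_⟩
  · have : 0 ≤ (2 * C) ^ (p / 2 - 1) := by positivity
    nlinarith
  have hn' : (1 : ℝ) ≤ n := by exact_mod_cast hn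
  have hκ : (0 : ℝ) < 1 / (2 * C * n) := by positivity
  have h1 := abs_rpow_mul_sq_le hp hκ x h
  have h2 : (1 / (2 * C * n))⁻¹ ^ (p / 2 - 1) = (2 * C) ^ (p / 2 - 1) * (n : ℝ) ^ (p / 2 - 1) := by
    rw [one_div, inv_inv, Real.mul_rpow (by linarith) (by linarith)]
  rw [h2] at h1
  have h3 : 1 ≤ (n : ℝ) ^ (p / 2 - 1) := Real.one_le_rpow hn' (by linarith)
  have h4 := mul_le_mul_of_nonneg_left h1 (by linarith : 0 ≤ C)
  have h5 : C * (1 / (2 * C * n) * |x| ^ p) = 1 / (2 * n) * |x| ^ p := by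
    have : C ≠ 0 := by linarith
    field_simp
  have h6 : C * |h| ^ p ≤ C * ((n : ℝ) ^ (p / 2 - 1) * |h| ^ p) := by
    refine mul_le_mul_of_nonneg_left ?_ (by linarith)
    exact le_mul_of_one_le_left (by positivity) h3
  have := H x h
  nlinarith

lemma rpow_add_rpow_sub_one_le {s : ℝ} (hs : 1 ≤ s) {n : ℝ} (hn : 0 < n) :
    n ^ s + n ^ (s - 1) ≤ (n + 1) ^ s := by
  have e : ∀ m : ℝ, 0 < m → m ^ s = m * m ^ (s - 1) := fun m hm => by
    nth_rewrite 2 [← Real.rpow_one m]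
    rw [← Real.rpow_add hm]; ring_nf
  rw [e n hn, e (n + 1) (by linarith)]
  have : n ^ (s - 1) ≤ (n + 1) ^ (s - 1) := Real.rpow_le_rpow hn.le (by linarith) (by linarith)
  nlinarith

/-- A Marcinkiewicz-Zygmund inequality: the `p`-th absolute moment of a sum of `n` independent
centred random variables is of order `n ^ (p / 2)`. -/
theorem exists_integral_abs_sum_rpow_le {p : ℝ} (hp : 2 ≤ p) :
    ∃ K : ℝ, 0 < K ∧ ∀ {Ω : Type*} [MeasurableSpace Ω] (μ : Measure Ω) [IsProbabilityMeasure μ]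
      (X : ℕ → Ω → ℝ) (b : ℝ), iIndepFun X μ → (∀ i, Measurable (X i)) →
      (∀ i, ∫ ω, X i ω ∂μ = 0) → (∀ i, Integrable (fun ω => |X i ω| ^ p) μ) →
      (∀ i, ∫ ω, |X i ω| ^ p ∂μ ≤ b) → ∀ n : ℕ,
        Integrable (fun ω => |∑ i ∈ Finset.range n, X i ω| ^ p) μ ∧
        ∫ ω, |∑ i ∈ Finset.range n, X i ω| ^ p ∂μ ≤ K * (n : ℝ) ^ (p / 2) * b := by
  obtain ⟨C, hC, H⟩ := exists_abs_add_rpow_le_nat hp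
  refine ⟨2 * C, by linarith, ?_⟩
  intro Ω _ μ _ X b hind hmeas hzero hint hb n
  have hp0 : 0 < p := by linarith
  have hb0 : 0 ≤ b := le_trans (integral_nonneg fun ω => by positivity) (hb 0)
  have hmS : ∀ n, Measurable fun ω => ∑ i ∈ Finset.range n, X i ω := fun n =>
    Finset.measurable_sum _ fun i _ => hmeas i
  have hX1 : ∀ i, Integrable (X i) μ := fun i => by
    refine ((integrable_const (1 : ℝ)).add (hint i)).mono (hmeas i).aestronglyMeasurable (ae_of_all _ fun ω => ?_)
    have h0 : 0 ≤ |X i ω| ^ p := by positivity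
    change _ ≤ ‖1 + |X i ω| ^ p‖
    rw [Real.norm_eq_abs, Real.norm_of_nonneg (by linarith)]
    rcases le_total |X i ω| 1 with h | h
    · linarith
    · have := Real.rpow_le_rpow_of_exponent_le h (by linarith : 1 ≤ p)
      rw [Real.rpow_one] at this
      linarith
  induction n with
  | zero => simp [Real.zero_rpow hp0.ne', Real.zero_rpow (by positivity : p / 2 ≠ 0)]
  | succ n ih =>
    rcases Nat.eq_zero_or_pos n with rfl | hn
    -- The term 1 / (2n) requires n > 0, so the first summand is treated apart.
    · refine ⟨by simpa using hint 0, ?_⟩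
      simp only [zero_add, Finset.range_one, Finset.sum_singleton, Nat.cast_one, Real.one_rpow]
      nlinarith [hb 0]
    obtain ⟨ih1, ih2⟩ := ih
    set S : Ω → ℝ := fun ω => ∑ i ∈ Finset.range n, X i ω with hS
    have hSm : Measurable S := hmS n
    have hindS : IndepFun S (X n) μ := by
      have := hind.indepFun_finsetSum_of_notMem hmeas (s := Finset.range n) (i := n) (by simp)
      convert this using 1
      ext ω; simp [hS]
    have hφ : Measurable fun x : ℝ => |x| ^ (p - 2) * x := by fun_prop
    have hindT : IndepFun (fun ω => |S ω| ^ (p - 2) * S ω) (X n) μ :=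
      hindS.comp hφ measurable_id
    have hT : Integrable (fun ω => |S ω| ^ (p - 2) * S ω) μ := by
      refine ((integrable_const (1 : ℝ)).add ih1).mono (hφ.comp hSm).aestronglyMeasurable
        (ae_of_all _ fun ω => ?_)
      have h0 : 0 ≤ |S ω| ^ p := by positivity
      have h1 : 0 ≤ |S ω| ^ (p - 2) := by positivity
      change _ ≤ ‖1 + |S ω| ^ p‖
      rw [Real.norm_eq_abs, Real.norm_of_nonneg (by linarith), abs_mul, abs_of_nonneg h1]
      rcases le_total |S ω| 1 with h | h
      · have : |S ω| ^ (p - 2) ≤ 1 := Real.rpow_le_one (abs_nonneg _) h (by linarith)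
        nlinarith [abs_nonneg (S ω)]
      · rw [abs_rpow_eq_mul_sq (p := p) (x := S ω) (by rintro h'; simp [h'] at h; linarith), ← sq_abs]
        nlinarith [mul_nonneg h1 (mul_nonneg (abs_nonneg (S ω)) (sub_nonneg.2 h))]
    have hTX : Integrable (fun ω => (|S ω| ^ (p - 2) * S ω) * X n ω) μ :=
      hindT.integrable_mul hT (hX1 n)
    -- The linear term vanishes in the mean: the partial sum is independent of the next variable,
    -- which is centred.
    have hTX0 : ∫ ω, (|S ω| ^ (p - 2) * S ω) * X n ω ∂μ = 0 := by
      rw [hindT.integral_fun_mul_eq_mul_integral hT.aestronglyMeasurable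
        (hX1 n).aestronglyMeasurable, hzero n, mul_zero]
    have hsum : ∀ ω, ∑ i ∈ Finset.range (n + 1), X i ω = S ω + X n ω := fun ω => by
      rw [Finset.sum_range_succ]
    simp only [hsum]
    have hI1 : Integrable (fun ω => (1 + 1 / (2 * n)) * |S ω| ^ p) μ := ih1.const_mul _
    have hI2 : Integrable (fun ω => p * ((|S ω| ^ (p - 2) * S ω) * X n ω)) μ := hTX.const_mul _
    have hI3 : Integrable (fun ω => C * (n : ℝ) ^ (p / 2 - 1) * |X n ω| ^ p) μ :=
      (hint n).const_mul _
    have hI : Integrable (fun ω => (1 + 1 / (2 * n)) * |S ω| ^ p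
        + p * ((|S ω| ^ (p - 2) * S ω) * X n ω) + C * (n : ℝ) ^ (p / 2 - 1) * |X n ω| ^ p) μ :=
      (hI1.add hI2).add hI3
    have hle : ∀ ω, |S ω + X n ω| ^ p ≤ (1 + 1 / (2 * n)) * |S ω| ^ p
        + p * ((|S ω| ^ (p - 2) * S ω) * X n ω) + C * (n : ℝ) ^ (p / 2 - 1) * |X n ω| ^ p :=
      fun ω => by
        have := H n (S ω) (X n ω) hn
        linarith
    have hint' : Integrable (fun ω => |S ω + X n ω| ^ p) μ := by
      refine hI.mono' ?_ (ae_of_all _ fun ω => ?_)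
      · have hm := hmeas n
        have : Measurable fun ω => |S ω + X n ω| ^ p := by fun_prop
        exact this.aestronglyMeasurable
      · rw [Real.norm_of_nonneg (by positivity)]
        exact hle ω
    refine ⟨hint', (integral_mono hint' hI hle).trans ?_⟩
    rw [integral_add (hI1.fun_add hI2) hI3, integral_add hI1 hI2, integral_const_mul,
      integral_const_mul, integral_const_mul, hTX0, mul_zero, add_zero]
    have hn' : (0 : ℝ) < n := by exact_mod_cast hn
    -- The growth factor adds C n^(p/2-1) b to the inductive bound and the new variable adds as much
    -- again; K = 2C makes the sum 2C (n^(p/2) + n^(p/2-1)) b, which is at most 2C (n+1)^(p/2) b.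
    have hkey := rpow_add_rpow_sub_one_le (s := p / 2) (by linarith) hn'
    have e1 : (n : ℝ) ^ (p / 2) = n * (n : ℝ) ^ (p / 2 - 1) := by
      nth_rewrite 2 [← Real.rpow_one (n : ℝ)]
      rw [← Real.rpow_add hn']; ring_nf
    have h1 := mul_le_mul_of_nonneg_left ih2 (by positivity : (0 : ℝ) ≤ 1 + 1 / (2 * n))
    have h2 := mul_le_mul_of_nonneg_left (hb n)
      (by positivity : (0 : ℝ) ≤ C * (n : ℝ) ^ (p / 2 - 1))
    have h3 : (1 + 1 / (2 * n)) * (2 * C * (n : ℝ) ^ (p / 2) * b)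
        = 2 * C * (n : ℝ) ^ (p / 2) * b + C * (n : ℝ) ^ (p / 2 - 1) * b := by
      rw [e1]; field_simp
    have h4 := mul_le_mul_of_nonneg_left hkey (by positivity : (0 : ℝ) ≤ 2 * C * b)
    push_cast
    nlinarith

/-! ### Bayes' formula: marginal law and posterior means. -/

namespace DecisionModel

section Bayes

variable {D Θ E : Type*} [MeasurableSpace Θ] [MeasurableSpace E] (M : DecisionModel D Θ E)

lemma measurable_lik_left (y : E) : Measurable fun θ => M.lik θ y :=
  M.lik_meas.comp (measurable_id.prodMk measurable_const)

lemma measurable_lik_right (θ : Θ) : Measurable fun y => M.lik θ y :=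
  M.lik_meas.comp (measurable_const.prodMk measurable_id)

lemma measurable_lik_comp {α : Type*} [MeasurableSpace α] {u : α → Θ} {v : α → E}
    (hu : Measurable u) (hv : Measurable v) : Measurable fun a => M.lik (u a) (v a) :=
  M.lik_meas.comp (hu.prodMk hv)

lemma measurable_marg : Measurable M.marg := by
  have : StronglyMeasurable fun y => ∫ θ, M.lik θ y ∂M.prior :=
    M.lik_meas.stronglyMeasurable.integral_prod_left
  exact this.measurable

/-- The posterior mean of `g` given `Y = y`. -/
noncomputable def posteriorMean (g : Θ → ℝ) (y : E) : ℝ :=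
  ∫ θ, g θ * M.posteriorDensity y θ ∂M.prior

lemma measurable_posteriorMean {g : Θ → ℝ} (hg : Measurable g) :
    Measurable (M.posteriorMean g) := by
  have h : Measurable (Function.uncurry fun θ y => g θ * M.posteriorDensity y θ) := by
    have h1 := M.measurable_marg
    have h2 := M.lik_meas
    unfold posteriorDensity
    exact (hg.comp measurable_fst).mul (h2.div (h1.comp measurable_snd))
  have : StronglyMeasurable fun y => ∫ θ, g θ * M.posteriorDensity y θ ∂M.prior :=
    h.stronglyMeasurable.integral_prod_left
  exact this.measurable

lemma lintegral_lintegral_lik :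
    ∫⁻ y, ∫⁻ θ, ENNReal.ofReal (M.lik θ y) ∂M.prior ∂M.ref = 1 := by
  rw [lintegral_lintegral_swap]
  · simp [M.lik_mass]
  · exact (M.lik_meas.comp measurable_swap).ennreal_ofReal.aemeasurable

lemma measurable_lintegral_lik :
    Measurable fun y => ∫⁻ θ, ENNReal.ofReal (M.lik θ y) ∂M.prior :=
  M.lik_meas.ennreal_ofReal.lintegral_prod_left'

lemma lawY_eq_withDensity :
    M.lawY = M.ref.withDensity fun y => ∫⁻ θ, ENNReal.ofReal (M.lik θ y) ∂M.prior := by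
  ext s hs
  have hL : Measurable fun z : Θ × E => ENNReal.ofReal (M.lik z.1 z.2) := M.lik_meas.ennreal_ofReal
  rw [lawY, jointLaw, Measure.snd_apply hs, withDensity_apply _ (measurable_snd hs),
    withDensity_apply _ hs, ← lintegral_indicator (measurable_snd hs),
    lintegral_prod_symm _ (hL.indicator (measurable_snd hs)).aemeasurable,
    ← lintegral_indicator hs]
  refine lintegral_congr fun y => ?_
  by_cases hy : y ∈ s <;> simp [Set.indicator, hy]

instance isProbabilityMeasure_lawY : IsProbabilityMeasure M.lawY := by
  constructor
  rw [lawY_eq_withDensity, withDensity_apply _ MeasurableSet.univ, setLIntegral_univ]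
  exact M.lintegral_lintegral_lik

lemma integrable_lik_of_lintegral_lt_top {y : E}
    (hy : ∫⁻ θ, ENNReal.ofReal (M.lik θ y) ∂M.prior < ⊤) :
    Integrable (fun θ => M.lik θ y) M.prior := by
  refine ⟨(M.measurable_lik_left y).aestronglyMeasurable, ?_⟩
  rw [hasFiniteIntegral_iff_ofReal (ae_of_all _ fun θ => M.lik_nonneg θ y)]
  exact hy

lemma marg_eq_toReal (y : E) :
    M.marg y = (∫⁻ θ, ENNReal.ofReal (M.lik θ y) ∂M.prior).toReal :=
  integral_eq_lintegral_of_nonneg_ae (ae_of_all _ fun θ => M.lik_nonneg θ y)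
    (M.measurable_lik_left y).aestronglyMeasurable

lemma ae_ref_lintegral_lik_lt_top :
    ∀ᵐ y ∂M.ref, ∫⁻ θ, ENNReal.ofReal (M.lik θ y) ∂M.prior < ⊤ :=
  ae_lt_top M.measurable_lintegral_lik (by rw [M.lintegral_lintegral_lik]; simp)

/-- The marginal density is defined by a Bochner integral, which is 0 when the likelihood is not
integrable in θ. This is excluded almost everywhere because the joint mass is 1, and zeros of the
density are null for the law of Y. -/
lemma ae_integrable_lik_and_marg_pos :
    ∀ᵐ y ∂M.lawY, Integrable (fun θ => M.lik θ y) M.prior ∧ 0 < M.marg y := by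
  rw [lawY_eq_withDensity, ae_withDensity_iff M.measurable_lintegral_lik]
  filter_upwards [M.ae_ref_lintegral_lik_lt_top] with y hy h0
  refine ⟨M.integrable_lik_of_lintegral_lt_top hy, ?_⟩
  rw [marg_eq_toReal]
  exact ENNReal.toReal_pos h0 hy.ne

lemma marg_mul_posteriorMean {g : Θ → ℝ} {y : E}
    (hy : Integrable (fun θ => M.lik θ y) M.prior) :
    M.marg y * M.posteriorMean g y = ∫ θ, g θ * M.lik θ y ∂M.prior := by
  unfold posteriorMean posteriorDensity
  rcases eq_or_ne (M.marg y) 0 with h | h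
  -- If the marginal density vanishes, so does the likelihood for almost every θ, and both sides are
  -- 0.
  · have h0 : (fun θ => M.lik θ y) =ᵐ[M.prior] 0 :=
      (integral_eq_zero_iff_of_nonneg (fun θ => M.lik_nonneg θ y) hy).1 h
    rw [h, zero_mul, eq_comm]
    refine integral_eq_zero_of_ae ?_
    filter_upwards [h0] with θ hθ
    simp only [Pi.zero_apply] at hθ ⊢
    rw [hθ, mul_zero]
  · rw [← integral_const_mul]
    refine integral_congr_ae (ae_of_all _ fun θ => ?_)
    simp only
    field_simp

lemma integrable_prod_lik :
    Integrable (Function.uncurry M.lik) (M.prior.prod M.ref) := by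
  refine ⟨M.lik_meas.aestronglyMeasurable, ?_⟩
  rw [hasFiniteIntegral_iff_ofReal (f := Function.uncurry M.lik)
    (ae_of_all _ fun z => M.lik_nonneg z.1 z.2),
    lintegral_prod _ M.lik_meas.ennreal_ofReal.aemeasurable]
  simp [Function.uncurry, M.lik_mass]

lemma integral_lik (θ : Θ) : ∫ y, M.lik θ y ∂M.ref = 1 := by
  rw [integral_eq_lintegral_of_nonneg_ae (ae_of_all _ fun y => M.lik_nonneg θ y)
    (M.measurable_lik_right θ).aestronglyMeasurable, M.lik_mass, ENNReal.toReal_one]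

/-- The law of total expectation for the posterior means. -/
lemma integral_posteriorMean {g : Θ → ℝ} (hg : Measurable g) {F : ℝ} (hF : ∀ θ, |g θ| ≤ F) :
    ∫ y, M.posteriorMean g y ∂M.lawY = ∫ θ, g θ ∂M.prior := by
  rw [lawY_eq_withDensity, integral_withDensity_eq_integral_toReal_smul
    M.measurable_lintegral_lik M.ae_ref_lintegral_lik_lt_top]
  -- The density of Y cancels the denominator of the posterior mean; Fubini then leaves the
  -- likelihood's total mass 1 for each θ.
  have h1 : ∫ y, (∫⁻ θ, ENNReal.ofReal (M.lik θ y) ∂M.prior).toReal • M.posteriorMean g y ∂M.ref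
      = ∫ y, ∫ θ, g θ * M.lik θ y ∂M.prior ∂M.ref := by
    refine integral_congr_ae ?_
    filter_upwards [M.ae_ref_lintegral_lik_lt_top] with y hy
    rw [← marg_eq_toReal, smul_eq_mul,
      M.marg_mul_posteriorMean (M.integrable_lik_of_lintegral_lt_top hy)]
  have hint : Integrable (Function.uncurry fun θ y => g θ * M.lik θ y) (M.prior.prod M.ref) :=
    M.integrable_prod_lik.bdd_mul (c := F) (hg.comp measurable_fst).aestronglyMeasurable
      (ae_of_all _ fun z => hF z.1)
  rw [h1, ← integral_integral_swap hint]
  refine integral_congr_ae (ae_of_all _ fun θ => ?_)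
  simp only
  rw [integral_const_mul, integral_lik, mul_one]

lemma integral_posteriorDensity {y : E} (hy : 0 < M.marg y) :
    ∫ θ, M.posteriorDensity y θ ∂M.prior = 1 := by
  unfold posteriorDensity
  rw [integral_div]
  exact div_self hy.ne'

lemma posteriorDensity_nonneg {y : E} (hy : 0 < M.marg y) (θ : Θ) :
    0 ≤ M.posteriorDensity y θ := div_nonneg (M.lik_nonneg θ y) hy.le

lemma integrable_posteriorDensity {y : E} (hi : Integrable (fun θ => M.lik θ y) M.prior) :
    Integrable (M.posteriorDensity y) M.prior := hi.div_const _

lemma integrable_mul_posteriorDensity {g : Θ → ℝ} (hg : Measurable g) {F : ℝ}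
    (hF : ∀ θ, |g θ| ≤ F) {y : E} (hi : Integrable (fun θ => M.lik θ y) M.prior) :
    Integrable (fun θ => g θ * M.posteriorDensity y θ) M.prior :=
  (M.integrable_posteriorDensity hi).bdd_mul (c := F) hg.aestronglyMeasurable
    (ae_of_all _ fun θ => hF θ)

lemma abs_posteriorMean_le {g : Θ → ℝ} {F : ℝ} (hF : ∀ θ, |g θ| ≤ F) {y : E}
    (hi : Integrable (fun θ => M.lik θ y) M.prior) (hy : 0 < M.marg y) :
    |M.posteriorMean g y| ≤ F := by
  unfold posteriorMean
  have h1 : ∫ θ, F * M.posteriorDensity y θ ∂M.prior = F := by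
    rw [integral_const_mul, M.integral_posteriorDensity hy, mul_one]
  calc |∫ θ, g θ * M.posteriorDensity y θ ∂M.prior|
      ≤ ∫ θ, F * M.posteriorDensity y θ ∂M.prior := by
        rw [← Real.norm_eq_abs]
        refine norm_integral_le_of_norm_le ((M.integrable_posteriorDensity hi).const_mul F)
          (ae_of_all _ fun θ => ?_)
        rw [norm_mul, Real.norm_of_nonneg (M.posteriorDensity_nonneg hy θ)]
        exact mul_le_mul_of_nonneg_right (hF θ) (M.posteriorDensity_nonneg hy θ)
    _ = F := h1

lemma integral_sub_posteriorMean_mul {g : Θ → ℝ} (hg : Measurable g) {F : ℝ}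
    (hF : ∀ θ, |g θ| ≤ F) {y : E} (hi : Integrable (fun θ => M.lik θ y) M.prior)
    (hy : 0 < M.marg y) :
    ∫ θ, (g θ - M.posteriorMean g y) * M.posteriorDensity y θ ∂M.prior = 0 := by
  simp_rw [sub_mul]
  rw [integral_sub (M.integrable_mul_posteriorDensity hg hF hi)
    ((M.integrable_posteriorDensity hi).const_mul _), integral_const_mul,
    M.integral_posteriorDensity hy, mul_one]
  exact sub_self _

end Bayes

end DecisionModel

/-! ### Deterministic estimates for maxima, ratios and antithetic differences. -/

namespace DecisionModel

section MaxD

variable {D : Type*} [Fintype D] [Nonempty D]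

lemma le_maxD (a : D → ℝ) (d : D) : a d ≤ maxD a :=
  Finset.le_sup' a (Finset.mem_univ d)

lemma maxD_le {a : D → ℝ} {c : ℝ} (h : ∀ d, a d ≤ c) : maxD a ≤ c :=
  Finset.sup'_le _ _ fun d _ => h d

lemma maxD_eq {a : D → ℝ} {d : D} (h : ∀ e, a e ≤ a d) : maxD a = a d :=
  le_antisymm (maxD_le h) (le_maxD a d)

lemma abs_maxD_le {a : D → ℝ} {c : ℝ} (h : ∀ d, |a d| ≤ c) : |maxD a| ≤ c := by
  rw [abs_le]
  refine ⟨?_, maxD_le fun d => (le_abs_self _).trans (h d)⟩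
  obtain ⟨d⟩ := ‹Nonempty D›
  have h1 := (abs_le.1 (h d)).1
  exact h1.trans (le_maxD a d)

lemma abs_maxD_sub_maxD_le {a b : D → ℝ} {c : ℝ} (h : ∀ d, |a d - b d| ≤ c) :
    |maxD a - maxD b| ≤ c := by
  have h1 : maxD a ≤ maxD b + c := maxD_le fun d => by
    linarith [(abs_le.1 (h d)).2, le_maxD b d]
  have h2 : maxD b ≤ maxD a + c := maxD_le fun d => by
    linarith [(abs_le.1 (h d)).1, le_maxD a d]
  rw [abs_le]
  constructor <;> linarith

lemma measurable_maxD {α : Type*} [MeasurableSpace α] {g : D → α → ℝ}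
    (hg : ∀ d, Measurable (g d)) : Measurable fun x => maxD fun d => g d x := by
  have h := Finset.measurable_sup' (Finset.univ_nonempty (α := D)) (f := g) fun d _ => hg d
  convert h using 1
  ext x
  simp [maxD, Finset.sup'_apply]

end MaxD

section Antithetic

lemma abs_div_sub_le {A B G w : ℝ} (hB : |B - 1| ≤ 1 / 2) (hA : |A - G * B| ≤ w) :
    |A / B - G| ≤ 2 * w := by
  have hB' := (abs_le.1 hB).1
  have hB0 : 0 < B := by linarith
  have : A / B - G = (A - G * B) / B := by field_simp
  rw [this, abs_div, abs_of_pos hB0, div_le_iff₀ hB0]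
  have := (abs_nonneg _).trans hA
  nlinarith

lemma abs_antithetic_ratio_le {Aa Ab Ba Bb G w : ℝ} (hw : w ≤ 1 / 2) (hBa : |Ba - 1| ≤ w)
    (hBb : |Bb - 1| ≤ w) (hAa : |Aa - G * Ba| ≤ w) (hAb : |Ab - G * Bb| ≤ w) :
    |(Aa + Ab) / 2 / ((Ba + Bb) / 2) - (Aa / Ba + Ab / Bb) / 2| ≤ 4 * w ^ 2 := by
  have ha := abs_le.1 hBa
  have hb := abs_le.1 hBb
  have hBa0 : 0 < Ba := by linarith
  have hBb0 : 0 < Bb := by linarith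
  have hw0 : 0 ≤ w := (abs_nonneg _).trans hBa
  have hra := abs_div_sub_le (hBa.trans hw) hAa
  have hrb := abs_div_sub_le (hBb.trans hw) hAb
  have hr : |Aa / Ba - Ab / Bb| ≤ 4 * w := by
    calc |Aa / Ba - Ab / Bb| = |(Aa / Ba - G) - (Ab / Bb - G)| := by ring_nf
      _ ≤ _ := abs_sub _ _
      _ ≤ 4 * w := by linarith
  have hd : |Ba - Bb| ≤ 2 * w := by
    rw [abs_le]; constructor <;> linarith
  have hsum : 0 < Ba + Bb := by linarith
  -- This identity is the source of the quadratic order: both Ba - Bb and the difference of the two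
  -- ratios are O(w).
  have key : (Aa + Ab) / 2 / ((Ba + Bb) / 2) - (Aa / Ba + Ab / Bb) / 2
      = (Ba - Bb) * (Aa / Ba - Ab / Bb) / (2 * (Ba + Bb)) := by
    field_simp
    ring
  rw [key, abs_div, abs_mul, abs_of_pos (by linarith : 0 < 2 * (Ba + Bb)),
    div_le_iff₀ (by linarith)]
  calc |Ba - Bb| * |Aa / Ba - Ab / Bb| ≤ (2 * w) * (4 * w) :=
        mul_le_mul hd hr (abs_nonneg _) (by linarith)
    _ ≤ 4 * w ^ 2 * (2 * (Ba + Bb)) := by nlinarith [sq_nonneg w]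

variable {D : Type*} [Fintype D] [Nonempty D]

lemma abs_ratio_sub_maxD_sub_le {Am B Gm w : ℝ} {A G : D → ℝ} (hw : w ≤ 1 / 2)
    (hB : |B - 1| ≤ w) (hAm : |Am - Gm * B| ≤ w) (hA : ∀ d, |A d - G d * B| ≤ w) :
    |Am / B - (maxD fun d => A d / B) - (Gm - maxD G)| ≤ 4 * w := by
  have h1 := abs_div_sub_le (hB.trans hw) hAm
  have h2 : |(maxD fun d => A d / B) - maxD G| ≤ 2 * w :=
    abs_maxD_sub_maxD_le fun d => abs_div_sub_le (hB.trans hw) (hA d)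
  calc _ = |(Am / B - Gm) - ((maxD fun d => A d / B) - maxD G)| := by ring_nf
    _ ≤ _ := abs_sub _ _
    _ ≤ 4 * w := by linarith

lemma abs_half_add_sub_le {Aa Ab Ba Bb G w : ℝ} (ha : |Aa - G * Ba| ≤ w)
    (hb : |Ab - G * Bb| ≤ w) : |(Aa + Ab) / 2 - G * ((Ba + Bb) / 2)| ≤ w := by
  rw [abs_le] at *
  constructor <;> linarith [ha.1, ha.2, hb.1, hb.2]

/-- All three estimators lie within 4w of the same limit Gm - max G. No information on the optimal
decision is needed. -/
lemma abs_antithetic_le {Ama Amb Ba Bb Gm w : ℝ} {Aa Ab G : D → ℝ} (hw : w ≤ 1 / 2)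
    (hBa : |Ba - 1| ≤ w) (hBb : |Bb - 1| ≤ w) (hAma : |Ama - Gm * Ba| ≤ w)
    (hAmb : |Amb - Gm * Bb| ≤ w) (hAa : ∀ d, |Aa d - G d * Ba| ≤ w)
    (hAb : ∀ d, |Ab d - G d * Bb| ≤ w) :
    |(Ama + Amb) / 2 / ((Ba + Bb) / 2) - (maxD fun d => (Aa d + Ab d) / 2 / ((Ba + Bb) / 2))
      - ((Ama / Ba - maxD fun d => Aa d / Ba) + (Amb / Bb - maxD fun d => Ab d / Bb)) / 2|
      ≤ 8 * w := by
  have hB : |(Ba + Bb) / 2 - 1| ≤ w := by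
    rw [abs_le] at *
    constructor <;> linarith [hBa.1, hBa.2, hBb.1, hBb.2]
  have h1 := abs_ratio_sub_maxD_sub_le (A := fun d => (Aa d + Ab d) / 2) (G := G) hw hB
    (abs_half_add_sub_le hAma hAmb) fun d => abs_half_add_sub_le (hAa d) (hAb d)
  have h2 := abs_ratio_sub_maxD_sub_le hw hBa hAma hAa
  have h3 := abs_ratio_sub_maxD_sub_le hw hBb hAmb hAb
  rw [abs_le] at h1 h2 h3 ⊢
  constructor <;> linarith [h1.1, h1.2, h2.1, h2.2, h3.1, h3.2]

/-- Each ratio is within 2w of its limit, so a lead of more than 4w survives in all three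
estimators. The maxima then disappear and `abs_antithetic_ratio_le` applies to Am and to the optimal
decision. -/
lemma abs_antithetic_le_sq {Ama Amb Ba Bb Gm w : ℝ} {Aa Ab G : D → ℝ} (hw : w ≤ 1 / 2)
    (hBa : |Ba - 1| ≤ w) (hBb : |Bb - 1| ≤ w) (hAma : |Ama - Gm * Ba| ≤ w)
    (hAmb : |Amb - Gm * Bb| ≤ w) (hAa : ∀ d, |Aa d - G d * Ba| ≤ w)
    (hAb : ∀ d, |Ab d - G d * Bb| ≤ w) {dopt : D}
    (hgap : ∀ d, d ≠ dopt → 4 * w < G dopt - G d) :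
    |(Ama + Amb) / 2 / ((Ba + Bb) / 2) - (maxD fun d => (Aa d + Ab d) / 2 / ((Ba + Bb) / 2))
      - ((Ama / Ba - maxD fun d => Aa d / Ba) + (Amb / Bb - maxD fun d => Ab d / Bb)) / 2|
      ≤ 8 * w ^ 2 := by
  have hB : |(Ba + Bb) / 2 - 1| ≤ w := by
    rw [abs_le] at *
    constructor <;> linarith [hBa.1, hBa.2, hBb.1, hBb.2]
  have hmax : ∀ {A : D → ℝ} {B : ℝ}, |B - 1| ≤ w → (∀ d, |A d - G d * B| ≤ w) →
      (maxD fun d => A d / B) = A dopt / B := fun {A B} hB hA => by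
    refine maxD_eq (a := fun d => A d / B) fun d => ?_
    rcases eq_or_ne d dopt with rfl | hd
    · exact le_rfl
    · have h1 := (abs_le.1 (abs_div_sub_le (hB.trans hw) (hA d))).2
      have h2 := (abs_le.1 (abs_div_sub_le (hB.trans hw) (hA dopt))).1
      linarith [hgap d hd]
  rw [hmax hBa hAa, hmax hBb hAb, hmax (A := fun d => (Aa d + Ab d) / 2) hB fun d =>
    abs_half_add_sub_le (hAa d) (hAb d)]
  have h1 := abs_antithetic_ratio_le hw hBa hBb hAma hAmb
  have h2 := abs_antithetic_ratio_le hw hBa hBb (hAa dopt) (hAb dopt)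
  rw [abs_le] at h1 h2 ⊢
  constructor <;> linarith [h1.1, h1.2, h2.1, h2.2]

end Antithetic

section Avg

variable {Θ : Type*}

lemma avg_sub (g h : Θ → ℝ) (t : ℕ → Θ) (a m : ℕ) :
    avg (fun θ => g θ - h θ) t a m = avg g t a m - avg h t a m := by
  simp [avg, Finset.sum_sub_distrib, sub_div]

lemma avg_const_mul (c : ℝ) (g : Θ → ℝ) (t : ℕ → Θ) (a m : ℕ) :
    avg (fun θ => c * g θ) t a m = c * avg g t a m := by
  simp [avg, ← Finset.mul_sum, mul_div_assoc]

lemma avg_div_const (c : ℝ) (g : Θ → ℝ) (t : ℕ → Θ) (a m : ℕ) :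
    avg (fun θ => g θ / c) t a m = avg g t a m / c := by
  simp [avg, ← Finset.sum_div, div_right_comm]

lemma avg_const (c : ℝ) (t : ℕ → Θ) (a : ℕ) {m : ℕ} (hm : 0 < m) :
    avg (fun _ => c) t a m = c := by
  have : (m : ℝ) ≠ 0 := by positivity
  simp [avg, this]

lemma avg_two_mul (g : Θ → ℝ) (t : ℕ → Θ) (a m : ℕ) :
    avg g t a (2 * m) = (avg g t a m + avg g t (a + m) m) / 2 := by
  simp only [avg, two_mul, Finset.sum_range_add, Nat.cast_add, add_assoc]
  rw [← add_div, ← two_mul (m : ℝ), div_div, mul_comm]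

lemma abs_avg_mul_le {g h : Θ → ℝ} {F : ℝ} (hF : ∀ θ, |g θ| ≤ F) (hh : ∀ θ, 0 ≤ h θ)
    (t : ℕ → Θ) (a m : ℕ) : |avg (fun θ => g θ * h θ) t a m| ≤ F * avg h t a m := by
  unfold avg
  rw [abs_div, abs_of_nonneg (Nat.cast_nonneg m : (0 : ℝ) ≤ m), ← mul_div_assoc, Finset.mul_sum]
  refine div_le_div_of_nonneg_right ?_ (Nat.cast_nonneg m)
  refine (Finset.abs_sum_le_sum_abs _ _).trans (Finset.sum_le_sum fun i _ => ?_)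
  rw [abs_mul, abs_of_nonneg (hh _)]
  exact mul_le_mul_of_nonneg_right (hF _) (hh _)

lemma avg_nonneg {h : Θ → ℝ} (hh : ∀ θ, 0 ≤ h θ) (t : ℕ → Θ) (a m : ℕ) : 0 ≤ avg h t a m :=
  div_nonneg (Finset.sum_nonneg fun _ _ => hh _) (Nat.cast_nonneg m)

lemma abs_avg_mul_div_avg_le {g h : Θ → ℝ} {F : ℝ} (hF0 : 0 ≤ F) (hF : ∀ θ, |g θ| ≤ F)
    (hh : ∀ θ, 0 ≤ h θ) (t : ℕ → Θ) (a m : ℕ) :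
    |avg (fun θ => g θ * h θ) t a m / avg h t a m| ≤ F := by
  rw [abs_div, abs_of_nonneg (avg_nonneg hh t a m)]
  -- This form also covers a vanishing denominator, where the quotient is 0.
  exact div_le_of_le_mul₀ (avg_nonneg hh t a m) hF0 (abs_avg_mul_le hF hh t a m)

end Avg

/-! ### Pointwise bounds for the estimator in terms of the sample deviations. -/

section Estimator

variable {D Θ E : Type*} [MeasurableSpace Θ] [MeasurableSpace E] (M : DecisionModel D Θ E)

/-- The normalized deviation of a weighted sample average of `g` from the posterior mean. -/
noncomputable def meanDev (g : Θ → ℝ) (a m : ℕ) (x : E × (ℕ → Θ)) : ℝ :=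
  |avg (fun θ => (g θ - M.posteriorMean g x.1) * M.posteriorDensity x.1 θ) x.2 a m|

/-- The deviation of the sample average of the normalized weights from `1`. -/
noncomputable def weightDev (a m : ℕ) (x : E × (ℕ → Θ)) : ℝ :=
  |avg (fun θ => M.posteriorDensity x.1 θ - 1) x.2 a m|

lemma meanDev_nonneg (g : Θ → ℝ) (a m : ℕ) (x : E × (ℕ → Θ)) : 0 ≤ M.meanDev g a m x :=
  abs_nonneg _

lemma weightDev_nonneg (a m : ℕ) (x : E × (ℕ → Θ)) : 0 ≤ M.weightDev a m x :=
  abs_nonneg _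

lemma meanDev_eq (g : Θ → ℝ) (a m : ℕ) (x : E × (ℕ → Θ)) :
    M.meanDev g a m x = |avg (fun θ => g θ * M.posteriorDensity x.1 θ) x.2 a m
      - M.posteriorMean g x.1 * avg (M.posteriorDensity x.1) x.2 a m| := by
  simp only [meanDev, sub_mul, avg_sub, avg_const_mul]

lemma weightDev_eq (a : ℕ) {m : ℕ} (hm : 0 < m) (x : E × (ℕ → Θ)) :
    M.weightDev a m x = |avg (M.posteriorDensity x.1) x.2 a m - 1| := by
  rw [weightDev, avg_sub, avg_const _ _ _ hm]

variable [Fintype D] [Nonempty D]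

/-- The net benefit under perfect information. -/
noncomputable def bestBenefit (θ : Θ) : ℝ := maxD fun d => M.f d θ

lemma measurable_bestBenefit : Measurable M.bestBenefit := measurable_maxD M.f_meas

/-- The sum of the deviations of all the sample averages entering the ratio estimator. -/
noncomputable def totalDev (a m : ℕ) (x : E × (ℕ → Θ)) : ℝ :=
  M.weightDev a m x + M.meanDev M.bestBenefit a m x + ∑ d, M.meanDev (M.f d) a m x

lemma totalDev_nonneg (a m : ℕ) (x : E × (ℕ → Θ)) : 0 ≤ M.totalDev a m x :=
  add_nonneg (add_nonneg (M.weightDev_nonneg a m x) (M.meanDev_nonneg _ a m x))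
    (Finset.sum_nonneg fun _ _ => M.meanDev_nonneg _ a m x)

lemma weightDev_le_totalDev (a m : ℕ) (x : E × (ℕ → Θ)) :
    M.weightDev a m x ≤ M.totalDev a m x := by
  have h1 := M.meanDev_nonneg M.bestBenefit a m x
  have h2 : 0 ≤ ∑ d, M.meanDev (M.f d) a m x :=
    Finset.sum_nonneg fun _ _ => M.meanDev_nonneg _ a m x
  unfold totalDev
  linarith

lemma meanDev_bestBenefit_le_totalDev (a m : ℕ) (x : E × (ℕ → Θ)) :
    M.meanDev M.bestBenefit a m x ≤ M.totalDev a m x := by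
  have h1 := M.weightDev_nonneg a m x
  have h2 : 0 ≤ ∑ d, M.meanDev (M.f d) a m x :=
    Finset.sum_nonneg fun _ _ => M.meanDev_nonneg _ a m x
  unfold totalDev
  linarith

lemma meanDev_le_totalDev (d : D) (a m : ℕ) (x : E × (ℕ → Θ)) :
    M.meanDev (M.f d) a m x ≤ M.totalDev a m x := by
  have h1 := M.weightDev_nonneg a m x
  have h2 := M.meanDev_nonneg M.bestBenefit a m x
  have h3 : M.meanDev (M.f d) a m x ≤ ∑ d, M.meanDev (M.f d) a m x :=
    Finset.single_le_sum (f := fun d => M.meanDev (M.f d) a m x)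
      (fun _ _ => M.meanDev_nonneg _ a m x) (Finset.mem_univ d)
  unfold totalDev
  linarith

/-- The common factor 1 / ρ(y) cancels in each ratio, so the weights may be normalized to have prior
mean 1. -/
lemma ratioEst_eq (a m : ℕ) {x : E × (ℕ → Θ)} (hx : M.marg x.1 ≠ 0) :
    M.ratioEst a m x = avg (fun θ => M.bestBenefit θ * M.posteriorDensity x.1 θ) x.2 a m
        / avg (M.posteriorDensity x.1) x.2 a m
      - maxD fun d => avg (fun θ => M.f d θ * M.posteriorDensity x.1 θ) x.2 a m
        / avg (M.posteriorDensity x.1) x.2 a m := by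
  have h1 : ∀ g : Θ → ℝ, avg (fun θ => g θ * M.posteriorDensity x.1 θ) x.2 a m
      = avg (fun θ => g θ * M.lik θ x.1) x.2 a m / M.marg x.1 := fun g => by
    simp only [posteriorDensity, ← mul_div_assoc, avg_div_const]
  have h2 : avg (M.posteriorDensity x.1) x.2 a m
      = avg (fun θ => M.lik θ x.1) x.2 a m / M.marg x.1 := avg_div_const _ _ _ _ _
  simp only [h1, h2, div_div_div_cancel_right₀ hx]
  rfl

lemma abs_bestBenefit_le {F : ℝ} (hF : ∀ d θ, |M.f d θ| ≤ F) (θ : Θ) : |M.bestBenefit θ| ≤ F :=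
  abs_maxD_le fun d => hF d θ

lemma abs_ratioEst_le {F : ℝ} (hF0 : 0 ≤ F) (hF : ∀ d θ, |M.f d θ| ≤ F) (a m : ℕ)
    (x : E × (ℕ → Θ)) : |M.ratioEst a m x| ≤ 2 * F := by
  have h1 := abs_avg_mul_div_avg_le hF0 (M.abs_bestBenefit_le hF)
    (fun θ => M.lik_nonneg θ x.1) x.2 a m
  have h2 : |maxD fun d => avg (fun θ => M.f d θ * M.lik θ x.1) x.2 a m
      / avg (fun θ => M.lik θ x.1) x.2 a m| ≤ F := abs_maxD_le fun d =>
    abs_avg_mul_div_avg_le hF0 (hF d) (fun θ => M.lik_nonneg θ x.1) x.2 a m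
  refine (abs_sub _ _).trans ?_
  change |avg (fun θ => M.bestBenefit θ * M.lik θ x.1) x.2 a m
      / avg (fun θ => M.lik θ x.1) x.2 a m| + _ ≤ _
  linarith

lemma abs_deltaP_le {F : ℝ} (hF0 : 0 ≤ F) (hF : ∀ d θ, |M.f d θ| ≤ F) (M₀ ℓ : ℕ)
    (x : E × (ℕ → Θ)) : |M.deltaP M₀ ℓ x| ≤ 4 * F := by
  have H := fun a m => abs_le.1 (M.abs_ratioEst_le hF0 hF a m x)
  cases ℓ with
  | zero =>
    have := H 0 M₀
    rw [deltaP, abs_le]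
    constructor <;> linarith
  | succ ℓ =>
    have h1 := H 0 (M₀ * 2 ^ (ℓ + 1))
    have h2 := H 0 (M₀ * 2 ^ ℓ)
    have h3 := H (M₀ * 2 ^ ℓ) (M₀ * 2 ^ ℓ)
    rw [deltaP, abs_le]
    constructor <;> linarith

lemma abs_ratioEst_sub_le {a m : ℕ} (hm : 0 < m) {x : E × (ℕ → Θ)} (hx : M.marg x.1 ≠ 0)
    (hw : M.totalDev a m x ≤ 1 / 2) :
    |M.ratioEst a m x - (M.posteriorMean M.bestBenefit x.1 - maxD fun d => M.G d x.1)|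
      ≤ 4 * M.totalDev a m x := by
  rw [M.ratioEst_eq a m hx]
  refine abs_ratio_sub_maxD_sub_le hw ?_ ?_ fun d => ?_
  · rw [← M.weightDev_eq a hm]
    exact M.weightDev_le_totalDev a m x
  · rw [← meanDev_eq]
    exact M.meanDev_bestBenefit_le_totalDev a m x
  · have := M.meanDev_le_totalDev d a m x
    rwa [meanDev_eq] at this

/-- The sum of the deviations in the two halves of the block of inner samples on level `ℓ + 1`. -/
noncomputable def levelDev (m : ℕ) (x : E × (ℕ → Θ)) : ℝ :=
  M.totalDev 0 m x + M.totalDev m m x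

lemma levelDev_nonneg (m : ℕ) (x : E × (ℕ → Θ)) : 0 ≤ M.levelDev m x :=
  add_nonneg (M.totalDev_nonneg 0 m x) (M.totalDev_nonneg m m x)

lemma deltaP_succ_eq (M₀ ℓ : ℕ) {x : E × (ℕ → Θ)} (hx : M.marg x.1 ≠ 0) :
    M.deltaP M₀ (ℓ + 1) x =
      let m := M₀ * 2 ^ ℓ
      let A := fun (g : Θ → ℝ) a => avg (fun θ => g θ * M.posteriorDensity x.1 θ) x.2 a m
      let B := fun a => avg (M.posteriorDensity x.1) x.2 a m
      (A M.bestBenefit 0 + A M.bestBenefit m) / 2 / ((B 0 + B m) / 2)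
        - (maxD fun d => (A (M.f d) 0 + A (M.f d) m) / 2 / ((B 0 + B m) / 2))
        - ((A M.bestBenefit 0 / B 0 - maxD fun d => A (M.f d) 0 / B 0)
          + (A M.bestBenefit m / B m - maxD fun d => A (M.f d) m / B m)) / 2 := by
  have h : M₀ * 2 ^ (ℓ + 1) = 2 * (M₀ * 2 ^ ℓ) := by ring
  simp only [deltaP, h, M.ratioEst_eq _ _ hx, avg_two_mul, zero_add]

lemma level_bounds {M₀ ℓ : ℕ} (hM₀ : 0 < M₀) (x : E × (ℕ → Θ)) {a : ℕ}
    (ha : a = 0 ∨ a = M₀ * 2 ^ ℓ) :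
    |avg (M.posteriorDensity x.1) x.2 a (M₀ * 2 ^ ℓ) - 1| ≤ M.levelDev (M₀ * 2 ^ ℓ) x ∧
    |avg (fun θ => M.bestBenefit θ * M.posteriorDensity x.1 θ) x.2 a (M₀ * 2 ^ ℓ)
      - M.posteriorMean M.bestBenefit x.1 * avg (M.posteriorDensity x.1) x.2 a (M₀ * 2 ^ ℓ)|
      ≤ M.levelDev (M₀ * 2 ^ ℓ) x ∧
    ∀ d, |avg (fun θ => M.f d θ * M.posteriorDensity x.1 θ) x.2 a (M₀ * 2 ^ ℓ)
      - M.G d x.1 * avg (M.posteriorDensity x.1) x.2 a (M₀ * 2 ^ ℓ)|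
      ≤ M.levelDev (M₀ * 2 ^ ℓ) x := by
  have hm : 0 < M₀ * 2 ^ ℓ := by positivity
  have h : M.totalDev a (M₀ * 2 ^ ℓ) x ≤ M.levelDev (M₀ * 2 ^ ℓ) x := by
    have h1 := M.totalDev_nonneg 0 (M₀ * 2 ^ ℓ) x
    have h2 := M.totalDev_nonneg (M₀ * 2 ^ ℓ) (M₀ * 2 ^ ℓ) x
    unfold levelDev
    rcases ha with rfl | rfl <;> linarith
  refine ⟨?_, ?_, fun d => ?_⟩
  · rw [← M.weightDev_eq a hm]
    exact (M.weightDev_le_totalDev a _ x).trans h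
  · rw [← meanDev_eq]
    exact (M.meanDev_bestBenefit_le_totalDev a _ x).trans h
  · have := (M.meanDev_le_totalDev d a _ x).trans h
    rwa [meanDev_eq] at this

lemma abs_deltaP_succ_le {M₀ ℓ : ℕ} (hM₀ : 0 < M₀) {x : E × (ℕ → Θ)} (hx : M.marg x.1 ≠ 0)
    (hw : M.levelDev (M₀ * 2 ^ ℓ) x ≤ 1 / 2) :
    |M.deltaP M₀ (ℓ + 1) x| ≤ 8 * M.levelDev (M₀ * 2 ^ ℓ) x := by
  rw [M.deltaP_succ_eq M₀ ℓ hx]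
  obtain ⟨h1, h2, h3⟩ := M.level_bounds hM₀ x (ℓ := ℓ) (a := 0) (Or.inl rfl)
  obtain ⟨k1, k2, k3⟩ := M.level_bounds hM₀ x (ℓ := ℓ) (a := M₀ * 2 ^ ℓ) (Or.inr rfl)
  exact abs_antithetic_le hw h1 k1 h2 k2 h3 k3

lemma abs_deltaP_succ_le_sq {M₀ ℓ : ℕ} (hM₀ : 0 < M₀) {x : E × (ℕ → Θ)} (hx : M.marg x.1 ≠ 0)
    (hw : M.levelDev (M₀ * 2 ^ ℓ) x ≤ 1 / 2) {dopt : D}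
    (hgap : ∀ d, d ≠ dopt → 4 * M.levelDev (M₀ * 2 ^ ℓ) x < M.G dopt x.1 - M.G d x.1) :
    |M.deltaP M₀ (ℓ + 1) x| ≤ 8 * M.levelDev (M₀ * 2 ^ ℓ) x ^ 2 := by
  rw [M.deltaP_succ_eq M₀ ℓ hx]
  obtain ⟨h1, h2, h3⟩ := M.level_bounds hM₀ x (ℓ := ℓ) (a := 0) (Or.inl rfl)
  obtain ⟨k1, k2, k3⟩ := M.level_bounds hM₀ x (ℓ := ℓ) (a := M₀ * 2 ^ ℓ) (Or.inr rfl)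
  exact abs_antithetic_le_sq hw h1 k1 h2 k2 h3 k3 hgap

end Estimator

end DecisionModel

/-! ### Moments of the sample deviations. -/

lemma one_add_rpow_le {p r : ℝ} (hp : 0 ≤ p) (hr : 0 ≤ r) :
    (1 + r) ^ p ≤ 2 ^ p * (1 + r ^ p) := by
  have hr0 : 0 ≤ r ^ p := by positivity
  have h2 : 0 ≤ (2 : ℝ) ^ p := by positivity
  rcases le_total r 1 with h | h
  · have := Real.rpow_le_rpow (by linarith) (by linarith : 1 + r ≤ 2) hp
    nlinarith
  · have := Real.rpow_le_rpow (by linarith) (by linarith : 1 + r ≤ 2 * r) hp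
    rw [Real.mul_rpow (by norm_num) hr] at this
    nlinarith

lemma add_rpow_le_mul_add_rpow {p a b : ℝ} (hp : 1 ≤ p) (ha : 0 ≤ a) (hb : 0 ≤ b) :
    (a + b) ^ p ≤ 2 ^ (p - 1) * (a ^ p + b ^ p) := by
  have := Real.rpow_sum_le_const_mul_sum_rpow_of_nonneg (f := ![a, b]) Finset.univ hp (by
    intro i _
    fin_cases i
    exacts [ha, hb])
  simpa using this

namespace DecisionModel

section Moments

/-- The constant depends on p only; it is chosen before the law and the function because the bound
is used for every value of Y separately. -/
lemma exists_integral_abs_avg_rpow_le {p : ℝ} (hp : 2 ≤ p) :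
    ∃ K : ℝ, 0 < K ∧ ∀ {Θ : Type*} [MeasurableSpace Θ] (P : Measure Θ) [IsProbabilityMeasure P]
      (h : Θ → ℝ), Measurable h → ∫ θ, h θ ∂P = 0 → Integrable (fun θ => |h θ| ^ p) P →
      ∀ a m : ℕ, 0 < m →
        Integrable (fun t => |avg h t a m| ^ p) (Measure.infinitePi fun _ : ℕ => P) ∧
        ∫ t, |avg h t a m| ^ p ∂(Measure.infinitePi fun _ : ℕ => P)
          ≤ K * (m : ℝ) ^ (-(p / 2)) * ∫ θ, |h θ| ^ p ∂P := by
  obtain ⟨K, hK, H⟩ := exists_integral_abs_sum_rpow_le hp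
  refine ⟨K, hK, ?_⟩
  intro Θ _ P _ h hm h0 hint a m hmpos
  have hmp : ∀ i : ℕ, MeasurePreserving (fun t : ℕ → Θ => t i)
      (Measure.infinitePi fun _ : ℕ => P) P := fun i =>
    measurePreserving_eval_infinitePi (fun _ : ℕ => P) i
  have hind : iIndepFun (fun (i : ℕ) (t : ℕ → Θ) => h (t (a + i)))
      (Measure.infinitePi fun _ : ℕ => P) := by
    have h1 := iIndepFun_infinitePi (P := fun _ : ℕ => P) (X := fun _ => h) fun _ => hm
    exact h1.precomp (add_right_injective a)
  have hpm : Measurable fun θ => |h θ| ^ p := by fun_prop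
  have hcomp : ∀ {f : Θ → ℝ}, Measurable f → ∀ i : ℕ,
      ∫ t, f (t i) ∂(Measure.infinitePi fun _ : ℕ => P) = ∫ θ, f θ ∂P := fun hf i => by
    have := integral_map (μ := Measure.infinitePi fun _ : ℕ => P)
      (measurable_pi_apply i).aemeasurable hf.aestronglyMeasurable
    rw [(hmp i).map_eq] at this
    exact this.symm
  have hI : ∀ i : ℕ, ∫ t, |h (t (a + i))| ^ p ∂(Measure.infinitePi fun _ : ℕ => P)
      = ∫ θ, |h θ| ^ p ∂P := fun i => by
    exact hcomp hpm (a + i)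
  have := H (Measure.infinitePi fun _ : ℕ => P) (fun i t => h (t (a + i)))
    (∫ θ, |h θ| ^ p ∂P) hind (fun i => hm.comp (measurable_pi_apply _)) (fun i =>
      (hcomp hm (a + i)).trans h0) (fun i =>
      (hmp (a + i)).integrable_comp_of_integrable hint) (fun i => (hI i).le) m
  have hm0 : (0 : ℝ) < m := by exact_mod_cast hmpos
  have e : ∀ t : ℕ → Θ, |avg h t a m| ^ p
      = |∑ i ∈ Finset.range m, h (t (a + i))| ^ p * (m : ℝ) ^ (-p) := fun t => by
    rw [avg, abs_div, abs_of_pos hm0, Real.div_rpow (abs_nonneg _) hm0.le, Real.rpow_neg hm0.le,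
      div_eq_mul_inv]
  simp only [e]
  refine ⟨this.1.mul_const _, ?_⟩
  rw [integral_mul_const]
  refine (mul_le_mul_of_nonneg_right this.2 (by positivity)).trans (le_of_eq ?_)
  have : (m : ℝ) ^ (-(p / 2)) = (m : ℝ) ^ (p / 2) * (m : ℝ) ^ (-p) := by
    rw [← Real.rpow_add hm0]; ring_nf
  rw [this]; ring

variable {D Θ E : Type*} [MeasurableSpace Θ] [MeasurableSpace E] (M : DecisionModel D Θ E)

/-- The law of one sample: `Y` together with an independent i.i.d. sequence from the prior. -/
noncomputable def sampleLaw : Measure (E × (ℕ → Θ)) :=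
  M.lawY.prod (Measure.infinitePi fun _ => M.prior)

instance isProbabilityMeasure_sampleLaw : IsProbabilityMeasure M.sampleLaw := by
  unfold sampleLaw; infer_instance

lemma measurable_posteriorDensity :
    Measurable fun z : E × Θ => M.posteriorDensity z.1 z.2 :=
  (M.measurable_lik_comp measurable_snd measurable_fst).div (M.measurable_marg.comp measurable_fst)

lemma measurable_avg_uncurry {H : E → Θ → ℝ} (hH : Measurable (Function.uncurry H)) (a m : ℕ) :
    Measurable fun x : E × (ℕ → Θ) => avg (H x.1) x.2 a m := by
  unfold avg
  refine (Finset.measurable_sum _ fun i _ => ?_).div_const _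
  exact hH.comp (measurable_fst.prodMk ((measurable_pi_apply (a + i)).comp measurable_snd))

lemma measurable_posteriorMoment (p : ℝ) :
    Measurable fun y => ∫⁻ θ, ENNReal.ofReal (M.posteriorDensity y θ ^ p) ∂M.prior := by
  have : Measurable fun z : E × Θ => ENNReal.ofReal (M.posteriorDensity z.1 z.2 ^ p) :=
    (M.measurable_posteriorDensity.pow_const p).ennreal_ofReal
  exact this.lintegral_prod_right'

/-- The moment bound for averages of centred functions dominated by the likelihood ratio. -/
lemma exists_lintegral_avg_rpow_le {p : ℝ} (hp : 2 ≤ p) (hmom : M.LikelihoodRatioMoment p)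
    (c : ℝ) : ∃ C : ℝ, 0 < C ∧ ∀ H : E → Θ → ℝ, Measurable (Function.uncurry H) →
      (∀ᵐ y ∂M.lawY, ∫ θ, H y θ ∂M.prior = 0) →
      (∀ᵐ y ∂M.lawY, ∀ θ, |H y θ| ≤ c * (1 + M.posteriorDensity y θ)) →
      ∀ a m : ℕ, 0 < m →
        ∫⁻ x, ENNReal.ofReal (|avg (H x.1) x.2 a m| ^ p) ∂M.sampleLaw
          ≤ ENNReal.ofReal (C * (m : ℝ) ^ (-(p / 2))) := by
  obtain ⟨K, hK, HK⟩ := exists_integral_abs_avg_rpow_le hp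
  have hp0 : 0 ≤ p := by linarith
  have hmom' : ∫⁻ y, ∫⁻ θ, ENNReal.ofReal (M.posteriorDensity y θ ^ p) ∂M.prior ∂M.lawY < ⊤ := hmom
  set κ := (∫⁻ y, ∫⁻ θ, ENNReal.ofReal (M.posteriorDensity y θ ^ p) ∂M.prior ∂M.lawY).toReal
    with hκ
  have hκ0 : 0 ≤ κ := ENNReal.toReal_nonneg
  refine ⟨K * ((|c| + 1) ^ p * 2 ^ p) * (1 + κ), by positivity, ?_⟩
  intro H hH hzero hdom a m hm
  set B : ℝ := K * (m : ℝ) ^ (-(p / 2)) * ((|c| + 1) ^ p * 2 ^ p) with hB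
  have hB0 : 0 ≤ B := by positivity
  -- With Y = y fixed, the average is one of i.i.d. centred variables whose p-th moment is
  -- controlled by that of the likelihood ratio. Integrating over y brings in the moment hypothesis.
  have hfib : ∀ᵐ y ∂M.lawY,
      ∫⁻ t, ENNReal.ofReal (|avg (H y) t a m| ^ p) ∂(Measure.infinitePi fun _ => M.prior)
        ≤ ENNReal.ofReal B
          * (1 + ∫⁻ θ, ENNReal.ofReal (M.posteriorDensity y θ ^ p) ∂M.prior) := by
    filter_upwards [hzero, hdom, M.ae_integrable_lik_and_marg_pos,
      ae_lt_top (M.measurable_posteriorMoment p) hmom'.ne] with y h0 hd hreg hfin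
    have hr0 : ∀ θ, 0 ≤ M.posteriorDensity y θ := M.posteriorDensity_nonneg hreg.2
    have hHm : Measurable (H y) := hH.comp measurable_prodMk_left
    have hrm : Measurable (M.posteriorDensity y) :=
      M.measurable_posteriorDensity.comp measurable_prodMk_left
    have hrint : Integrable (fun θ => M.posteriorDensity y θ ^ p) M.prior := by
      refine ⟨(hrm.pow_const p).aestronglyMeasurable, ?_⟩
      rw [hasFiniteIntegral_iff_ofReal (ae_of_all _ fun θ => Real.rpow_nonneg (hr0 θ) p)]
      exact hfin
    have hbound : ∀ θ, |H y θ| ^ p ≤ ((|c| + 1) ^ p * 2 ^ p)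
        * (1 + M.posteriorDensity y θ ^ p) := fun θ => by
      have h1 : |H y θ| ≤ (|c| + 1) * (1 + M.posteriorDensity y θ) := by
        refine (hd θ).trans (mul_le_mul_of_nonneg_right ?_ (by linarith [hr0 θ]))
        linarith [le_abs_self c]
      have h2 := Real.rpow_le_rpow (abs_nonneg _) h1 hp0
      rw [Real.mul_rpow (by positivity) (by linarith [hr0 θ])] at h2
      have h3 := mul_le_mul_of_nonneg_left (one_add_rpow_le hp0 (hr0 θ))
        (by positivity : 0 ≤ (|c| + 1) ^ p)
      linarith
    have hdomint : Integrable (fun θ => ((|c| + 1) ^ p * 2 ^ p)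
        * (1 + M.posteriorDensity y θ ^ p)) M.prior :=
      ((integrable_const 1).add hrint).const_mul _
    have hHint : Integrable (fun θ => |H y θ| ^ p) M.prior := by
      have hmm : Measurable fun θ => |H y θ| ^ p := by fun_prop
      refine hdomint.mono' hmm.aestronglyMeasurable (ae_of_all _ fun θ => ?_)
      rw [Real.norm_of_nonneg (by positivity)]
      exact hbound θ
    obtain ⟨k1, k2⟩ := HK M.prior (H y) hHm h0 hHint a m hm
    rw [← ofReal_integral_eq_lintegral_ofReal k1 (ae_of_all _ fun t => by positivity),
      ← ofReal_integral_eq_lintegral_ofReal hrint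
        (ae_of_all _ fun θ => Real.rpow_nonneg (hr0 θ) p),
      ← ENNReal.ofReal_one, ← ENNReal.ofReal_add zero_le_one
        (integral_nonneg fun θ => Real.rpow_nonneg (hr0 θ) p), ← ENNReal.ofReal_mul hB0]
    refine ENNReal.ofReal_le_ofReal (k2.trans ?_)
    have h4 : ∫ θ, |H y θ| ^ p ∂M.prior ≤ ((|c| + 1) ^ p * 2 ^ p)
        * (1 + ∫ θ, M.posteriorDensity y θ ^ p ∂M.prior) := by
      refine (integral_mono hHint hdomint hbound).trans (le_of_eq ?_)
      rw [integral_const_mul, integral_add (integrable_const 1) hrint]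
      simp
    refine (mul_le_mul_of_nonneg_left h4 (by positivity)).trans (le_of_eq ?_)
    rw [hB]; ring
  have hmeas : Measurable fun x : E × (ℕ → Θ) => ENNReal.ofReal (|avg (H x.1) x.2 a m| ^ p) := by
    have h1 := measurable_avg_uncurry hH a m
    have h2 : Measurable fun x : E × (ℕ → Θ) => |avg (H x.1) x.2 a m| ^ p := by fun_prop
    exact h2.ennreal_ofReal
  rw [sampleLaw, lintegral_prod _ hmeas.aemeasurable]
  refine (lintegral_mono_ae hfib).trans ?_
  rw [lintegral_const_mul _ (measurable_const.fun_add (M.measurable_posteriorMoment p)),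
    lintegral_add_left measurable_const, lintegral_one, measure_univ,
    ← ENNReal.ofReal_toReal hmom'.ne, ← hκ, ← ENNReal.ofReal_one,
    ← ENNReal.ofReal_add zero_le_one hκ0, ← ENNReal.ofReal_mul hB0]
  refine ENNReal.ofReal_le_ofReal (le_of_eq ?_)
  rw [hB]; ring

lemma measurable_meanDev {g : Θ → ℝ} (hg : Measurable g) (a m : ℕ) :
    Measurable (M.meanDev g a m) := by
  have h : Measurable (Function.uncurry fun y θ =>
      (g θ - M.posteriorMean g y) * M.posteriorDensity y θ) :=
    ((hg.comp measurable_snd).sub ((M.measurable_posteriorMean hg).comp measurable_fst)).mul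
      M.measurable_posteriorDensity
  have := measurable_avg_uncurry h a m
  unfold meanDev
  exact continuous_abs.measurable.comp this

lemma measurable_weightDev (a m : ℕ) : Measurable (M.weightDev a m) := by
  have h : Measurable (Function.uncurry fun y θ => M.posteriorDensity y θ - 1) :=
    M.measurable_posteriorDensity.sub_const 1
  have := measurable_avg_uncurry h a m
  unfold weightDev
  exact continuous_abs.measurable.comp this

lemma exists_lintegral_meanDev_rpow_le {p : ℝ} (hp : 2 ≤ p) (hmom : M.LikelihoodRatioMoment p)
    (F : ℝ) : ∃ C : ℝ, 0 < C ∧ ∀ g : Θ → ℝ, Measurable g → (∀ θ, |g θ| ≤ F) →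
      ∀ a m : ℕ, 0 < m → ∫⁻ x, ENNReal.ofReal (M.meanDev g a m x ^ p) ∂M.sampleLaw
          ≤ ENNReal.ofReal (C * (m : ℝ) ^ (-(p / 2))) := by
  obtain ⟨C, hC, H⟩ := M.exists_lintegral_avg_rpow_le hp hmom (2 * F)
  refine ⟨C, hC, fun g hg hF a m hm => ?_⟩
  refine H (fun y θ => (g θ - M.posteriorMean g y) * M.posteriorDensity y θ)
    (((hg.comp measurable_snd).sub ((M.measurable_posteriorMean hg).comp measurable_fst)).mul
      M.measurable_posteriorDensity) ?_ ?_ a m hm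
  · filter_upwards [M.ae_integrable_lik_and_marg_pos] with y hy
    exact M.integral_sub_posteriorMean_mul hg hF hy.1 hy.2
  · filter_upwards [M.ae_integrable_lik_and_marg_pos] with y hy θ
    have hr := M.posteriorDensity_nonneg hy.2 θ
    have h1 := M.abs_posteriorMean_le hF hy.1 hy.2
    have h2 := hF θ
    have h3 : |g θ - M.posteriorMean g y| ≤ 2 * F := (abs_sub _ _).trans (by linarith)
    rw [abs_mul, abs_of_nonneg hr]
    have := abs_nonneg (g θ - M.posteriorMean g y)
    nlinarith

lemma exists_lintegral_weightDev_rpow_le {p : ℝ} (hp : 2 ≤ p)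
    (hmom : M.LikelihoodRatioMoment p) : ∃ C : ℝ, 0 < C ∧
      ∀ a m : ℕ, 0 < m → ∫⁻ x, ENNReal.ofReal (M.weightDev a m x ^ p) ∂M.sampleLaw
          ≤ ENNReal.ofReal (C * (m : ℝ) ^ (-(p / 2))) := by
  obtain ⟨C, hC, H⟩ := M.exists_lintegral_avg_rpow_le hp hmom 1
  refine ⟨C, hC, fun a m hm => ?_⟩
  refine H (fun y θ => M.posteriorDensity y θ - 1) (M.measurable_posteriorDensity.sub_const 1)
    ?_ ?_ a m hm
  · filter_upwards [M.ae_integrable_lik_and_marg_pos] with y hy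
    rw [integral_sub (M.integrable_posteriorDensity hy.1) (integrable_const 1),
      M.integral_posteriorDensity hy.2]
    simp
  · filter_upwards [M.ae_integrable_lik_and_marg_pos] with y hy θ
    have hr := M.posteriorDensity_nonneg hy.2 θ
    rw [abs_le]
    constructor <;> linarith

variable [Fintype D] [Nonempty D]

lemma measurable_totalDev (a m : ℕ) : Measurable (M.totalDev a m) :=
  ((M.measurable_weightDev a m).add (M.measurable_meanDev M.measurable_bestBenefit a m)).add
    (Finset.measurable_sum _ fun d _ => M.measurable_meanDev (M.f_meas d) a m)

lemma totalDev_rpow_le {p : ℝ} (hp : 1 ≤ p) (a m : ℕ) (x : E × (ℕ → Θ)) :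
    M.totalDev a m x ^ p ≤ (Fintype.card (Option (Option D)) : ℝ) ^ (p - 1)
      * (M.weightDev a m x ^ p + (M.meanDev M.bestBenefit a m x ^ p
        + ∑ d, M.meanDev (M.f d) a m x ^ p)) := by
  -- The |D| + 2 deviations are indexed by `Option (Option D)` so that a single power mean
  -- inequality applies.
  let u : Option (Option D) → ℝ := fun o =>
    o.elim (M.weightDev a m x) fun o => o.elim (M.meanDev M.bestBenefit a m x)
      fun d => M.meanDev (M.f d) a m x
  have hu : ∀ o ∈ Finset.univ, 0 ≤ u o := by
    rintro (_ | _ | d) -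
    · exact M.weightDev_nonneg a m x
    · exact M.meanDev_nonneg _ a m x
    · exact M.meanDev_nonneg _ a m x
  have := Real.rpow_sum_le_const_mul_sum_rpow_of_nonneg Finset.univ hp hu
  simpa [u, Fintype.sum_option, totalDev, add_assoc] using this

theorem exists_integral_totalDev_rpow_le {p : ℝ} (hp : 2 ≤ p) (hbdd : M.BoundedBenefit)
    (hmom : M.LikelihoodRatioMoment p) : ∃ C : ℝ, 0 < C ∧ ∀ a m : ℕ, 0 < m →
      Integrable (fun x => M.totalDev a m x ^ p) M.sampleLaw ∧
      ∫ x, M.totalDev a m x ^ p ∂M.sampleLaw ≤ C * (m : ℝ) ^ (-(p / 2)) := by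
  obtain ⟨F, hF0, hF⟩ := hbdd
  obtain ⟨C₁, hC₁, H₁⟩ := M.exists_lintegral_weightDev_rpow_le hp hmom
  obtain ⟨C₂, hC₂, H₂⟩ := M.exists_lintegral_meanDev_rpow_le hp hmom F
  set N : ℝ := (Fintype.card (Option (Option D)) : ℝ) ^ (p - 1) with hN
  have hN0 : 0 < N := by
    have : 0 < Fintype.card (Option (Option D)) := Fintype.card_pos
    positivity
  refine ⟨N * (C₁ + (C₂ + Fintype.card D * C₂)), by positivity, fun a m hm => ?_⟩
  set s : ℝ := (m : ℝ) ^ (-(p / 2)) with hs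
  have hs0 : 0 ≤ s := by positivity
  have hmg : ∀ {g : Θ → ℝ}, Measurable g → Measurable fun x =>
      ENNReal.ofReal (M.meanDev g a m x ^ p) := fun hg =>
    ((M.measurable_meanDev hg a m).pow_const p).ennreal_ofReal
  have hmw : Measurable fun x => ENNReal.ofReal (M.weightDev a m x ^ p) :=
    ((M.measurable_weightDev a m).pow_const p).ennreal_ofReal
  have hl : ∫⁻ x, ENNReal.ofReal (M.totalDev a m x ^ p) ∂M.sampleLaw
      ≤ ENNReal.ofReal (N * (C₁ + (C₂ + Fintype.card D * C₂)) * s) := by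
    have hle : ∀ x, ENNReal.ofReal (M.totalDev a m x ^ p) ≤ ENNReal.ofReal N *
        (ENNReal.ofReal (M.weightDev a m x ^ p) +
          (ENNReal.ofReal (M.meanDev M.bestBenefit a m x ^ p)
            + ∑ d, ENNReal.ofReal (M.meanDev (M.f d) a m x ^ p))) := fun x => by
      have n1 := Real.rpow_nonneg (M.weightDev_nonneg a m x) p
      have n2 := fun g => Real.rpow_nonneg (M.meanDev_nonneg g a m x) p
      have n3 : 0 ≤ ∑ d, M.meanDev (M.f d) a m x ^ p := Finset.sum_nonneg fun d _ => n2 _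
      rw [← ENNReal.ofReal_sum_of_nonneg fun d _ => n2 _, ← ENNReal.ofReal_add (n2 _) n3,
        ← ENNReal.ofReal_add n1 (add_nonneg (n2 _) n3), ← ENNReal.ofReal_mul hN0.le]
      exact ENNReal.ofReal_le_ofReal (M.totalDev_rpow_le (by linarith) a m x)
    refine (lintegral_mono hle).trans ?_
    have hmsum : Measurable fun x => ∑ d, ENNReal.ofReal (M.meanDev (M.f d) a m x ^ p) :=
      Finset.measurable_sum _ fun d _ => hmg (M.f_meas d)
    rw [lintegral_const_mul _ (hmw.fun_add ((hmg M.measurable_bestBenefit).fun_add hmsum)),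
      lintegral_add_left hmw, lintegral_add_left (hmg M.measurable_bestBenefit),
      lintegral_finsetSum _ fun d _ => hmg (M.f_meas d)]
    have e : ENNReal.ofReal (N * (C₁ + (C₂ + Fintype.card D * C₂)) * s) = ENNReal.ofReal N *
        (ENNReal.ofReal (C₁ * s) + (ENNReal.ofReal (C₂ * s)
          + ∑ _d : D, ENNReal.ofReal (C₂ * s))) := by
      rw [← ENNReal.ofReal_sum_of_nonneg fun d _ => by positivity,
        ← ENNReal.ofReal_add (by positivity) (by positivity),
        ← ENNReal.ofReal_add (by positivity) (by positivity), ← ENNReal.ofReal_mul hN0.le]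
      congr 1
      simp only [Finset.sum_const, Finset.card_univ, nsmul_eq_mul]
      ring
    rw [e]
    gcongr with d
    · exact H₁ a m hm
    · exact H₂ _ M.measurable_bestBenefit (M.abs_bestBenefit_le hF) a m hm
    · exact H₂ _ (M.f_meas d) (hF d) a m hm
  have hnn : ∀ x, 0 ≤ M.totalDev a m x ^ p := fun x =>
    Real.rpow_nonneg (M.totalDev_nonneg a m x) p
  have hms := ((M.measurable_totalDev a m).pow_const p).aestronglyMeasurable (μ := M.sampleLaw)
  refine ⟨⟨hms, ?_⟩, ?_⟩
  · rw [hasFiniteIntegral_iff_ofReal (ae_of_all _ hnn)]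
    exact hl.trans_lt ENNReal.ofReal_lt_top
  · rw [integral_eq_lintegral_of_nonneg_ae (ae_of_all _ hnn) hms]
    exact ENNReal.toReal_le_of_le_ofReal (by positivity) hl

theorem exists_integral_levelDev_rpow_le {p : ℝ} (hp : 2 ≤ p) (hbdd : M.BoundedBenefit)
    (hmom : M.LikelihoodRatioMoment p) : ∃ C : ℝ, 0 < C ∧ ∀ m : ℕ, 0 < m →
      Integrable (fun x => M.levelDev m x ^ p) M.sampleLaw ∧
      ∫ x, M.levelDev m x ^ p ∂M.sampleLaw ≤ C * (m : ℝ) ^ (-(p / 2)) := by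
  obtain ⟨C, hC, H⟩ := M.exists_integral_totalDev_rpow_le hp hbdd hmom
  refine ⟨2 ^ (p - 1) * (2 * C), by positivity, fun m hm => ?_⟩
  obtain ⟨h1, h2⟩ := H 0 m hm
  obtain ⟨h3, h4⟩ := H m m hm
  have hI : Integrable (fun x => (2 : ℝ) ^ (p - 1)
      * (M.totalDev 0 m x ^ p + M.totalDev m m x ^ p)) M.sampleLaw := (h1.add h3).const_mul _
  have hle : ∀ x, M.levelDev m x ^ p ≤ (2 : ℝ) ^ (p - 1)
      * (M.totalDev 0 m x ^ p + M.totalDev m m x ^ p) := fun x =>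
    add_rpow_le_mul_add_rpow (by linarith) (M.totalDev_nonneg 0 m x) (M.totalDev_nonneg m m x)
  have hI' : Integrable (fun x => M.levelDev m x ^ p) M.sampleLaw := by
    refine hI.mono' (((M.measurable_totalDev 0 m).add
      (M.measurable_totalDev m m)).pow_const p).aestronglyMeasurable (ae_of_all _ fun x => ?_)
    rw [Real.norm_of_nonneg (Real.rpow_nonneg (M.levelDev_nonneg m x) p)]
    exact hle x
  refine ⟨hI', (integral_mono hI' hI hle).trans ?_⟩
  rw [integral_const_mul, integral_add h1 h3, mul_assoc]
  refine mul_le_mul_of_nonneg_left (by linarith) (by positivity)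

end Moments

end DecisionModel

/-! ### Decay of the antithetic corrections. -/

/-- Markov's inequality in pointwise form: a lower bound on w trades the power q for the power p. -/
lemma rpow_le_mul_rpow_of_le {w δ q p : ℝ} (hδ : 0 < δ) (hw : δ ≤ w) (hq : q ≤ p) :
    w ^ q ≤ δ ^ (q - p) * w ^ p := by
  have hw0 : 0 < w := hδ.trans_le hw
  have h1 : w ^ q = w ^ (q - p) * w ^ p := by
    rw [← Real.rpow_add hw0]; ring_nf
  rw [h1]
  exact mul_le_mul_of_nonneg_right (Real.rpow_le_rpow_of_nonpos hδ hw (by linarith)) (by positivity)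

namespace DecisionModel

section Levels

variable {D Θ E : Type*} [MeasurableSpace Θ] [MeasurableSpace E] (M : DecisionModel D Θ E)

lemma ae_sampleLaw_of_ae_lawY {P : E → Prop} (h : ∀ᵐ y ∂M.lawY, P y) :
    ∀ᵐ x ∂M.sampleLaw, P x.1 :=
  Measure.quasiMeasurePreserving_fst.ae h

lemma exists_isOptimal_of_notMem_K {y : E} (hy : 0 < M.marg y) (hK : y ∉ M.K) :
    ∃ d, M.IsOptimal d y := by
  by_contra h
  exact hK ⟨hy, fun ⟨d, hd, _⟩ => h ⟨d, hd⟩⟩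

variable [Fintype D] [Nonempty D]

lemma measurable_ratioEst (a m : ℕ) : Measurable (M.ratioEst a m) := by
  have hL : Measurable fun z : E × Θ => M.lik z.2 z.1 :=
    M.measurable_lik_comp measurable_snd measurable_fst
  have h0 : Measurable fun x : E × (ℕ → Θ) => avg (fun θ => M.lik θ x.1) x.2 a m :=
    measurable_avg_uncurry (H := fun y θ => M.lik θ y) hL a m
  have h1 : ∀ {g : Θ → ℝ}, Measurable g → Measurable fun x : E × (ℕ → Θ) =>
      avg (fun θ => g θ * M.lik θ x.1) x.2 a m := fun {g} hg =>
    measurable_avg_uncurry (H := fun y θ => g θ * M.lik θ y) ((hg.comp measurable_snd).mul hL) a m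
  exact ((h1 M.measurable_bestBenefit).div h0).sub
    (measurable_maxD fun d => (h1 (M.f_meas d)).div h0)

lemma measurable_deltaP (M₀ ℓ : ℕ) : Measurable (M.deltaP M₀ ℓ) := by
  cases ℓ with
  | zero => exact M.measurable_ratioEst 0 M₀
  | succ ℓ =>
    exact (M.measurable_ratioEst _ _).sub
      (((M.measurable_ratioEst _ _).add (M.measurable_ratioEst _ _)).div_const 2)

open Classical in
/-- The pointwise bound for the antithetic correction, with the decision boundary at scale `ε`. -/
lemma exists_ae_abs_deltaP_rpow_le [PseudoEMetricSpace E] {p q : ℝ} (hp : 2 ≤ p) (hq1 : 1 ≤ q)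
    (hq2 : q ≤ 2) (hbdd : M.BoundedBenefit) (hsep : M.LinearSeparation) :
    ∃ C : ℝ, 0 < C ∧ ∀ (M₀ ℓ : ℕ) (ε : ℝ), 0 < M₀ → 0 < ε → ε < 1 →
      ∀ᵐ x ∂M.sampleLaw, |M.deltaP M₀ (ℓ + 1) x| ^ q ≤ C * (ε ^ (q + 1)
        + ε ^ q * (if Metric.infEDist x.1 M.K ≤ ENNReal.ofReal ε then 1 else 0)
        + ε ^ (q - p) * M.levelDev (M₀ * 2 ^ ℓ) x ^ p) := by
  obtain ⟨F, hF0, hF⟩ := hbdd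
  obtain ⟨c₁, c₂, hc₁, hc₂, hsep⟩ := hsep
  set κ := min c₁ c₂ with hκ
  have hκ0 : 0 < κ := lt_min hc₁ hc₂
  set C₁ : ℝ := (4 * F) ^ q * (1 / 2) ^ (0 - p) with hC₁
  set C₂ : ℝ := 8 ^ q * (κ / 4) ^ (q - p) with hC₂
  have h8 : 0 < (8 : ℝ) ^ q := by positivity
  have hC₁0 : 0 < C₁ := by positivity
  have hC₂0 : 0 < C₂ := by positivity
  refine ⟨C₁ + C₂ + 8 ^ q, by positivity, fun M₀ ℓ ε hM₀ hε hε1 => ?_⟩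
  filter_upwards [M.ae_sampleLaw_of_ae_lawY M.ae_integrable_lik_and_marg_pos,
    M.ae_sampleLaw_of_ae_lawY hsep] with x hreg hsepx
  set w := M.levelDev (M₀ * 2 ^ ℓ) x with hw
  have hw0 : 0 ≤ w := M.levelDev_nonneg _ x
  set I : ℝ := if Metric.infEDist x.1 M.K ≤ ENNReal.ofReal ε then 1 else 0 with hI
  have hI0 : 0 ≤ I := by rw [hI]; split_ifs <;> norm_num
  set T₁ := ε ^ (q + 1) with hT₁
  set T₂ := ε ^ q * I with hT₂
  set T₃ := ε ^ (q - p) * w ^ p with hT₃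
  have hT₁0 : 0 ≤ T₁ := by positivity
  have hT₂0 : 0 ≤ T₂ := by positivity
  have hT₃0 : 0 ≤ T₃ := by positivity
  have suff : ∀ {C T : ℝ}, 0 ≤ C → C ≤ C₁ + C₂ + 8 ^ q → 0 ≤ T → T ≤ T₁ + T₂ + T₃ →
      C * T ≤ (C₁ + C₂ + 8 ^ q) * (T₁ + T₂ + T₃) := fun h1 h2 h3 h4 =>
    mul_le_mul h2 h4 h3 (by linarith)
  have habs : 0 ≤ |M.deltaP M₀ (ℓ + 1) x| := abs_nonneg _
  have hq0 : 0 ≤ q := by linarith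
  -- For w > 1/2 the ratios are uncontrolled, but the correction is bounded by 4F and 1 ≤ 2^p w^p.
  rcases lt_or_ge (1 / 2) w with hwbig | hwsmall
  · refine le_trans ?_ (suff hC₁0.le (by linarith) hT₃0 (by linarith))
    have h1 := Real.rpow_le_rpow habs (M.abs_deltaP_le hF0.le hF M₀ (ℓ + 1) x) hq0
    have h2 := rpow_le_mul_rpow_of_le (q := 0) (p := p) (by norm_num) hwbig.le (by linarith)
    rw [Real.rpow_zero] at h2
    have h3 : 1 ≤ ε ^ (q - p) :=
      Real.one_le_rpow_of_pos_of_le_one_of_nonpos hε hε1.le (by linarith)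
    have h4 : w ^ p ≤ T₃ := le_mul_of_one_le_left (by positivity) h3
    have h5 : (1 : ℝ) ≤ (1 / 2) ^ (0 - p) * T₃ :=
      h2.trans (mul_le_mul_of_nonneg_left h4 (by positivity))
    calc _ ≤ (4 * F) ^ q := h1
      _ ≤ (4 * F) ^ q * ((1 / 2) ^ (0 - p) * T₃) := le_mul_of_one_le_right (by positivity) h5
      _ = C₁ * T₃ := by rw [hC₁]; ring
  have hlin : |M.deltaP M₀ (ℓ + 1) x| ^ q ≤ 8 ^ q * w ^ q := by
    rw [← Real.mul_rpow (by norm_num) hw0]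
    exact Real.rpow_le_rpow habs (M.abs_deltaP_succ_le hM₀ hreg.2.ne' hwsmall) hq0
  rcases le_or_gt ε w with hεw | hwε
  · refine le_trans ?_ (suff h8.le (by linarith) hT₃0 (by linarith))
    exact hlin.trans (mul_le_mul_of_nonneg_left
      (rpow_le_mul_rpow_of_le hε hεw (by linarith)) h8.le)
  -- From here on w < ε. Near K only the linear bound is available, and the indicator pays for it.
  by_cases hdist : Metric.infEDist x.1 M.K ≤ ENNReal.ofReal ε
  · refine le_trans ?_ (suff h8.le (by linarith) hT₂0 (by linarith))
    refine hlin.trans (mul_le_mul_of_nonneg_left ?_ h8.le)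
    rw [hT₂, hI, if_pos hdist, mul_one]
    exact Real.rpow_le_rpow hw0 hwε.le hq0
  have hxK : x.1 ∉ M.K := fun h => hdist (by rw [Metric.infEDist_zero_of_mem h]; exact zero_le)
  obtain ⟨dopt, hdopt⟩ := M.exists_isOptimal_of_notMem_K hreg.2 hxK
  -- Taking κ = min c₁ c₂ handles both terms of the separation bound at once; ε < 1 is used for c₁.
  have hgap : ∀ d, d ≠ dopt → κ * ε < M.G dopt x.1 - M.G d x.1 := fun d hd => by
    have h1 := hsepx hxK dopt hdopt d hd
    have h2 : ENNReal.ofReal (κ * ε)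
        ≤ min (ENNReal.ofReal c₁) (ENNReal.ofReal c₂ * Metric.infEDist x.1 M.K) := by
      refine le_min (ENNReal.ofReal_le_ofReal ?_) ?_
      · have := min_le_left c₁ c₂
        nlinarith
      · rw [ENNReal.ofReal_mul hκ0.le]
        exact mul_le_mul' (ENNReal.ofReal_le_ofReal (min_le_right _ _)) (not_le.1 hdist).le
    exact (ENNReal.ofReal_lt_ofReal_iff_of_nonneg (by positivity)).1 (h2.trans_lt h1)
  -- The quadratic bound requires the gap κ ε to exceed 4w; failing that, w ≥ κ ε / 4 and the large
  -- deviation bound applies again at this smaller threshold.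
  rcases lt_or_ge (4 * w) (κ * ε) with hs | hs
  · refine le_trans ?_ (suff h8.le (by linarith) hT₁0 (by linarith))
    have h1 := M.abs_deltaP_succ_le_sq hM₀ hreg.2.ne' hwsmall fun d hd => hs.trans (hgap d hd)
    have h2 := Real.rpow_le_rpow habs h1 hq0
    rw [Real.mul_rpow (by norm_num) (by positivity)] at h2
    refine h2.trans (mul_le_mul_of_nonneg_left ?_ h8.le)
    calc (w ^ 2) ^ q ≤ (ε ^ 2) ^ q :=
          Real.rpow_le_rpow (by positivity) (pow_le_pow_left₀ hw0 hwε.le 2) hq0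
      _ = ε ^ (2 * q) := by rw [← Real.rpow_natCast ε 2, ← Real.rpow_mul hε.le]; norm_num
      -- Here q ≥ 1 enters: away from K the contribution is no worse than near K.
      _ ≤ ε ^ (q + 1) := Real.rpow_le_rpow_of_exponent_ge hε hε1.le (by linarith)
  · refine le_trans ?_ (suff hC₂0.le (by linarith) hT₃0 (by linarith))
    have h1 := rpow_le_mul_rpow_of_le (w := w) (δ := κ / 4 * ε) (q := q) (p := p)
      (by positivity) (by linarith) (by linarith)
    rw [Real.mul_rpow (by positivity) hε.le] at h1
    calc _ ≤ 8 ^ q * w ^ q := hlin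
      _ ≤ 8 ^ q * ((κ / 4) ^ (q - p) * ε ^ (q - p) * w ^ p) := mul_le_mul_of_nonneg_left h1 h8.le
      _ = C₂ * T₃ := by rw [hC₂, hT₃]; ring

lemma integrable_abs_deltaP_rpow (hbdd : M.BoundedBenefit) {q : ℝ} (hq : 0 ≤ q) (M₀ ℓ : ℕ) :
    Integrable (fun x => |M.deltaP M₀ ℓ x| ^ q) M.sampleLaw := by
  obtain ⟨F, hF0, hF⟩ := hbdd
  have h1 := M.measurable_deltaP M₀ ℓ
  have h2 : Measurable fun x => |M.deltaP M₀ ℓ x| ^ q := by fun_prop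
  refine (integrable_const ((4 * F) ^ q)).mono' h2.aestronglyMeasurable (ae_of_all _ fun x => ?_)
  rw [Real.norm_of_nonneg (by positivity)]
  exact Real.rpow_le_rpow (abs_nonneg _) (M.abs_deltaP_le hF0.le hF M₀ ℓ x) hq

lemma exists_integral_abs_deltaP_rpow_le_add [PseudoEMetricSpace E] [OpensMeasurableSpace E]
    {p q : ℝ} (hp : 2 ≤ p) (hq1 : 1 ≤ q) (hq2 : q ≤ 2) (hbdd : M.BoundedBenefit)
    (hK : M.ManifoldProbBound) (hsep : M.LinearSeparation) (hmom : M.LikelihoodRatioMoment p) :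
    ∃ C : ℝ, 0 < C ∧ ∀ (M₀ ℓ : ℕ) (ε : ℝ), 0 < M₀ → 0 < ε → ε < 1 →
      ∫ x, |M.deltaP M₀ (ℓ + 1) x| ^ q ∂M.sampleLaw
        ≤ C * (ε ^ (q + 1) + ε ^ (q - p) * ((M₀ * 2 ^ ℓ : ℕ) : ℝ) ^ (-(p / 2))) := by
  classical
  obtain ⟨C, hC, H⟩ := M.exists_ae_abs_deltaP_rpow_le hp hq1 hq2 hbdd hsep
  obtain ⟨C', hC', H'⟩ := M.exists_integral_levelDev_rpow_le hp hbdd hmom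
  obtain ⟨c₀, hc₀, hK⟩ := hK
  refine ⟨C * (1 + c₀ + C'), by positivity, fun M₀ ℓ ε hM₀ hε hε1 => ?_⟩
  obtain ⟨hI3, hI3'⟩ := H' (M₀ * 2 ^ ℓ) (by positivity)
  set S : Set E := {y | Metric.infEDist y M.K ≤ ENNReal.ofReal ε} with hS
  have hSm : MeasurableSet S :=
    (isClosed_le Metric.continuous_infEDist continuous_const).measurableSet
  have hSm' : MeasurableSet (Prod.fst ⁻¹' S : Set (E × (ℕ → Θ))) := measurable_fst hSm
  have hind : (fun x : E × (ℕ → Θ) =>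
      if Metric.infEDist x.1 M.K ≤ ENNReal.ofReal ε then (1 : ℝ) else 0)
        = (Prod.fst ⁻¹' S).indicator fun _ => 1 := by
    ext x
    simp [Set.indicator, hS]
  have hI2 : Integrable (fun x : E × (ℕ → Θ) =>
      if Metric.infEDist x.1 M.K ≤ ENNReal.ofReal ε then (1 : ℝ) else 0) M.sampleLaw := by
    rw [hind]
    exact (integrable_const (1 : ℝ)).indicator hSm'
  have hI2' : ∫ x : E × (ℕ → Θ), (if Metric.infEDist x.1 M.K ≤ ENNReal.ofReal ε then (1 : ℝ)
      else 0) ∂M.sampleLaw ≤ c₀ * ε := by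
    rw [hind, integral_indicator_const _ hSm', smul_eq_mul, mul_one, measureReal_def]
    have h1 : M.sampleLaw (Prod.fst ⁻¹' S) = M.lawY S := by
      rw [← Measure.map_apply measurable_fst hSm, sampleLaw, Measure.map_fst_prod, measure_univ,
        one_smul]
    rw [h1]
    exact ENNReal.toReal_le_of_le_ofReal (by positivity) (hK ε hε hε1)
  have J1 : Integrable (fun _ : E × (ℕ → Θ) => ε ^ (q + 1)) M.sampleLaw := integrable_const _
  have J2 := hI2.const_mul (ε ^ q)
  have J3 := hI3.const_mul (ε ^ (q - p))
  refine (integral_mono_ae (M.integrable_abs_deltaP_rpow hbdd (by linarith) M₀ (ℓ + 1))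
    (((J1.fun_add J2).fun_add J3).const_mul C) (H M₀ ℓ ε hM₀ hε hε1)).trans ?_
  rw [integral_const_mul, integral_add (J1.fun_add J2) J3, integral_add J1 J2,
    integral_const_mul, integral_const_mul, integral_const, probReal_univ, one_smul, mul_assoc]
  refine mul_le_mul_of_nonneg_left ?_ hC.le
  set s := ((M₀ * 2 ^ ℓ : ℕ) : ℝ) ^ (-(p / 2)) with hs
  have hs0 : 0 ≤ s := by positivity
  have e1 : ε ^ (q + 1) = ε ^ q * ε := by rw [Real.rpow_add hε, Real.rpow_one]
  have h2 := mul_le_mul_of_nonneg_left hI2' (by positivity : 0 ≤ ε ^ q)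
  have h3 := mul_le_mul_of_nonneg_left hI3' (by positivity : 0 ≤ ε ^ (q - p))
  have h4 : 0 ≤ ε ^ (q - p) * s := by positivity
  have h5 : 0 ≤ ε ^ (q + 1) := by positivity
  have h6 : ε ^ q * (c₀ * ε) = c₀ * ε ^ (q + 1) := by rw [e1]; ring
  rw [h6] at h2
  nlinarith [mul_nonneg hc₀.le h4, mul_nonneg hC'.le h5]

/-- The moments of the antithetic corrections decay geometrically with the level. -/
theorem exists_integral_abs_deltaP_rpow_le [PseudoEMetricSpace E] [OpensMeasurableSpace E]
    {p q : ℝ} (hp : 2 ≤ p) (hq1 : 1 ≤ q) (hq2 : q ≤ 2) (hbdd : M.BoundedBenefit)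
    (hK : M.ManifoldProbBound) (hsep : M.LinearSeparation) (hmom : M.LikelihoodRatioMoment p)
    {M₀ : ℕ} (hM₀ : 0 < M₀) :
    ∃ C : ℝ, 0 < C ∧ ∀ ℓ : ℕ, ∫ x, |M.deltaP M₀ ℓ x| ^ q ∂M.sampleLaw
        ≤ C * (2 : ℝ) ^ (-(p / (2 * p + 2) * (q + 1)) * (ℓ : ℝ)) := by
  obtain ⟨C, hC, H⟩ := M.exists_integral_abs_deltaP_rpow_le_add hp hq1 hq2 hbdd hK hsep hmom
  have hI0 : 0 ≤ ∫ x, |M.deltaP M₀ 0 x| ^ q ∂M.sampleLaw := integral_nonneg fun x => by positivity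
  -- The added integral takes care of level 0, to which the antithetic estimates do not apply.
  refine ⟨C * (1 + 2 ^ (p / 2)) + ∫ x, |M.deltaP M₀ 0 x| ^ q ∂M.sampleLaw, by positivity,
    fun ℓ => ?_⟩
  cases ℓ with
  | zero =>
    simp only [Nat.cast_zero, mul_zero, Real.rpow_zero, mul_one]
    have : 0 ≤ C * (1 + 2 ^ (p / 2)) := by positivity
    linarith
  | succ ℓ =>
    set n : ℝ := ((ℓ + 1 : ℕ) : ℝ) with hn
    have hn0 : 0 < n := by positivity
    have hp1 : (0 : ℝ) < 2 * p + 2 := by linarith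
    have ha : 0 < p / (2 * p + 2) := by positivity
    -- This ε solves ε^(p+1) = 2^(-p n / 2), which makes the two terms of the bound comparable.
    set ε : ℝ := (2 : ℝ) ^ (-(p / (2 * p + 2)) * n) with hε
    have hε0 : 0 < ε := by positivity
    have hε1 : ε < 1 := Real.rpow_lt_one_of_one_lt_of_neg (by norm_num) (by nlinarith)
    -- The half blocks on level n hold M₀ 2^(n-1) samples; the missing factor 2 accounts for
    -- 2^(p/2).
    have key : ε ^ (q - p) * ((M₀ * 2 ^ ℓ : ℕ) : ℝ) ^ (-(p / 2)) ≤ 2 ^ (p / 2) * ε ^ (q + 1) := by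
      have h1 : ((M₀ * 2 ^ ℓ : ℕ) : ℝ) ^ (-(p / 2)) ≤ ((2 : ℝ) ^ (n - 1)) ^ (-(p / 2)) := by
        refine Real.rpow_le_rpow_of_nonpos (by positivity) ?_ (by linarith)
        have : (2 : ℝ) ^ (n - 1) = 2 ^ ℓ := by
          rw [hn, ← Real.rpow_natCast]; congr 1; push_cast; ring
        rw [this]
        push_cast
        exact le_mul_of_one_le_left (by positivity) (by exact_mod_cast hM₀)
      refine (mul_le_mul_of_nonneg_left h1 (by positivity)).trans (le_of_eq ?_)
      rw [hε, ← Real.rpow_mul (by norm_num), ← Real.rpow_mul (by norm_num),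
        ← Real.rpow_mul (by norm_num), ← Real.rpow_add (by norm_num),
        ← Real.rpow_add (by norm_num)]
      congr 1
      field_simp
      ring
    refine (H M₀ ℓ ε hM₀ hε0 hε1).trans ?_
    have e : (2 : ℝ) ^ (-(p / (2 * p + 2) * (q + 1)) * n) = ε ^ (q + 1) := by
      rw [hε, ← Real.rpow_mul (by norm_num)]; congr 1; ring
    rw [e]
    have h2 := mul_le_mul_of_nonneg_left key hC.le
    have h3 : 0 ≤ ε ^ (q + 1) := by positivity
    nlinarith [mul_nonneg hI0 h3]

end Levels

end DecisionModel

/-! ### Telescoping and bias. -/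

lemma measurePreserving_infinitePi_shift {Θ : Type*} [MeasurableSpace Θ] (P : Measure Θ)
    [IsProbabilityMeasure P] (a : ℕ) :
    MeasurePreserving (fun (t : ℕ → Θ) i => t (a + i)) (Measure.infinitePi fun _ : ℕ => P)
      (Measure.infinitePi fun _ : ℕ => P) := by
  refine ⟨by fun_prop, ?_⟩
  have h1 := iIndepFun_infinitePi (P := fun _ : ℕ => P) (X := fun _ θ => θ) fun _ => measurable_id
  have h2 := h1.precomp (add_right_injective a)
  have h3 := (iIndepFun_iff_map_fun_eq_infinitePi_map (by
    intro i; exact measurable_pi_apply (a + i))).1 h2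
  refine h3.trans ?_
  congr 1
  ext1 i
  exact Measure.infinitePi_map_eval (fun _ : ℕ => P) (a + i)

namespace DecisionModel

section Bias

variable {D Θ E : Type*} [MeasurableSpace Θ] [MeasurableSpace E] (M : DecisionModel D Θ E)

lemma integral_sampleLaw_fst {g : E → ℝ} (hg : Measurable g) :
    ∫ x, g x.1 ∂M.sampleLaw = ∫ y, g y ∂M.lawY := by
  have h := integral_map (μ := M.sampleLaw) measurable_fst.aemeasurable hg.aestronglyMeasurable
  rw [sampleLaw, Measure.map_fst_prod, measure_univ, one_smul] at h
  exact h.symm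

variable [Fintype D] [Nonempty D]

/-- The i.i.d. sequence is shift invariant in law and stays independent of Y, so the second half
block has the same expectation as the first. This is what makes the sum over levels telescope. -/
lemma integral_ratioEst_shift (a m : ℕ) :
    ∫ x, M.ratioEst a m x ∂M.sampleLaw = ∫ x, M.ratioEst 0 m x ∂M.sampleLaw := by
  have hmp : MeasurePreserving (Prod.map id fun (t : ℕ → Θ) i => t (a + i))
      M.sampleLaw M.sampleLaw :=
    (MeasurePreserving.id M.lawY).prod (measurePreserving_infinitePi_shift M.prior a)
  have h := integral_map (μ := M.sampleLaw) hmp.measurable.aemeasurable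
    (M.measurable_ratioEst 0 m).aestronglyMeasurable
  rw [hmp.map_eq] at h
  rw [h]
  refine integral_congr_ae (ae_of_all _ fun x => ?_)
  simp [ratioEst, avg]

lemma integrable_ratioEst (hbdd : M.BoundedBenefit) (a m : ℕ) :
    Integrable (M.ratioEst a m) M.sampleLaw := by
  obtain ⟨F, hF0, hF⟩ := hbdd
  exact (integrable_const (2 * F)).mono' (M.measurable_ratioEst a m).aestronglyMeasurable
    (ae_of_all _ fun x => M.abs_ratioEst_le hF0.le hF a m x)

lemma sum_integral_deltaP (hbdd : M.BoundedBenefit) (M₀ L : ℕ) :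
    ∑ ℓ ∈ Finset.range (L + 1), ∫ x, M.deltaP M₀ ℓ x ∂M.sampleLaw
      = ∫ x, M.ratioEst 0 (M₀ * 2 ^ L) x ∂M.sampleLaw := by
  induction L with
  | zero => simp [deltaP]
  | succ L ih =>
    have hI := M.integrable_ratioEst hbdd
    rw [Finset.sum_range_succ, ih]
    simp only [deltaP]
    rw [integral_sub (hI _ _) (((hI _ _).fun_add (hI _ _)).div_const 2), integral_div,
      integral_add (hI _ _) (hI _ _), M.integral_ratioEst_shift (M₀ * 2 ^ L)]
    ring

lemma measurable_maxD_G : Measurable fun y => maxD fun d => M.G d y :=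
  measurable_maxD fun d => M.measurable_posteriorMean (M.f_meas d)

/-- The bias of the nested estimator with `m` inner samples is of order `m ^ (-1 / 2)`. -/
theorem exists_abs_integral_ratioEst_sub_le {p : ℝ} (hp : 2 ≤ p) (hbdd : M.BoundedBenefit)
    (hmom : M.LikelihoodRatioMoment p) :
    ∃ C : ℝ, 0 < C ∧ ∀ m : ℕ, 0 < m →
      |∫ x, M.ratioEst 0 m x ∂M.sampleLaw - (M.EVPI - M.EVSI)| ≤ C * (m : ℝ) ^ (-(1 / 2 : ℝ)) := by
  obtain ⟨C, hC, H⟩ := M.exists_integral_totalDev_rpow_le hp hbdd hmom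
  have hI := M.integrable_ratioEst hbdd
  obtain ⟨F, hF0, hF⟩ := hbdd
  refine ⟨(4 + 8 * F) * (1 + C), by positivity, fun m hm => ?_⟩
  have hm0 : (0 : ℝ) < m := by exact_mod_cast hm
  -- V(Y) is the limit of the estimator for infinitely many inner samples; by the law of total
  -- expectation its mean is EVPI - EVSI, the two prior maxima cancelling.
  set V : E → ℝ := fun y => M.posteriorMean M.bestBenefit y - maxD fun d => M.G d y with hV
  have hm1 := M.measurable_posteriorMean M.measurable_bestBenefit
  have hVm : Measurable V := hm1.sub M.measurable_maxD_G
  have hb1 : ∀ᵐ y ∂M.lawY, |M.posteriorMean M.bestBenefit y| ≤ F := by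
    filter_upwards [M.ae_integrable_lik_and_marg_pos] with y hy
    exact M.abs_posteriorMean_le (M.abs_bestBenefit_le hF) hy.1 hy.2
  have hb2 : ∀ᵐ y ∂M.lawY, |maxD fun d => M.G d y| ≤ F := by
    filter_upwards [M.ae_integrable_lik_and_marg_pos] with y hy
    exact abs_maxD_le fun d => M.abs_posteriorMean_le (hF d) hy.1 hy.2
  have hi1 : Integrable (M.posteriorMean M.bestBenefit) M.lawY :=
    (integrable_const F).mono' hm1.aestronglyMeasurable hb1
  have hi2 : Integrable (fun y => maxD fun d => M.G d y) M.lawY :=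
    (integrable_const F).mono' M.measurable_maxD_G.aestronglyMeasurable hb2
  have hVE : ∫ x, V x.1 ∂M.sampleLaw = M.EVPI - M.EVSI := by
    rw [M.integral_sampleLaw_fst hVm, integral_sub hi1 hi2,
      M.integral_posteriorMean M.measurable_bestBenefit (M.abs_bestBenefit_le hF)]
    unfold EVPI EVSI bestBenefit
    ring
  have hVb : ∀ᵐ x ∂M.sampleLaw, |V x.1| ≤ 2 * F := by
    filter_upwards [M.ae_sampleLaw_of_ae_lawY hb1, M.ae_sampleLaw_of_ae_lawY hb2] with x h1 h2
    exact (abs_sub _ _).trans (by linarith)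
  have hVI : Integrable (fun x => V x.1) M.sampleLaw :=
    (integrable_const (2 * F)).mono' (hVm.comp measurable_fst).aestronglyMeasurable hVb
  obtain ⟨h1, h2⟩ := H 0 m hm
  set δ : ℝ := (m : ℝ) ^ (-(1 / 2 : ℝ)) with hδ
  have hδ0 : 0 < δ := by positivity
  have hpt : ∀ᵐ x ∂M.sampleLaw, ‖M.ratioEst 0 m x - V x.1‖
      ≤ (4 + 8 * F) * (δ + δ ^ (1 - p) * M.totalDev 0 m x ^ p) := by
    filter_upwards [hVb, M.ae_sampleLaw_of_ae_lawY M.ae_integrable_lik_and_marg_pos] with x hVx hx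
    have hw0 := M.totalDev_nonneg 0 m x
    have hT0 : 0 ≤ δ ^ (1 - p) * M.totalDev 0 m x ^ p := by positivity
    -- A substitute for Hölder's inequality: with δ = m^(-1/2), integrating the right side gives
    -- O(δ).
    have hw : M.totalDev 0 m x ≤ δ + δ ^ (1 - p) * M.totalDev 0 m x ^ p := by
      rcases le_total (M.totalDev 0 m x) δ with h | h
      · linarith
      · have := rpow_le_mul_rpow_of_le (q := 1) (p := p) hδ0 h (by linarith)
        rw [Real.rpow_one] at this
        linarith
    refine le_trans ?_ (mul_le_mul_of_nonneg_left hw (by linarith))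
    rw [Real.norm_eq_abs]
    -- The error is at most 4w for w ≤ 1/2, and at most 4F ≤ 8F w otherwise.
    rcases le_or_gt (M.totalDev 0 m x) (1 / 2) with h | h
    · have := M.abs_ratioEst_sub_le hm hx.2.ne' h
      nlinarith [mul_nonneg hF0.le hw0]
    · have := (abs_sub (M.ratioEst 0 m x) (V x.1)).trans
        (add_le_add (M.abs_ratioEst_le hF0.le hF 0 m x) hVx)
      nlinarith [mul_nonneg hF0.le hw0]
  rw [← hVE, ← integral_sub (hI 0 m) hVI, ← Real.norm_eq_abs]
  have hc : Integrable (fun _ : E × (ℕ → Θ) => δ) M.sampleLaw := integrable_const δ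
  refine (norm_integral_le_of_norm_le ((hc.fun_add (h1.const_mul _)).const_mul _) hpt).trans ?_
  rw [integral_const_mul, integral_add hc (h1.const_mul _), integral_const_mul, integral_const,
    probReal_univ, one_smul, mul_assoc]
  refine mul_le_mul_of_nonneg_left ?_ (by linarith)
  have h3 := mul_le_mul_of_nonneg_left h2 (by positivity : 0 ≤ δ ^ (1 - p))
  have h4 : δ ^ (1 - p) * (C * (m : ℝ) ^ (-(p / 2))) = C * δ := by
    have : δ ^ (1 - p) * (m : ℝ) ^ (-(p / 2)) = δ := by
      rw [hδ, ← Real.rpow_mul hm0.le, ← Real.rpow_add hm0]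
      congr 1
      ring
    rw [← mul_assoc, mul_comm _ C, mul_assoc, this]
  linarith

end Bias

end DecisionModel

/-! ### Multilevel complexity. -/

/-- The choice of levels and sample numbers in the multilevel Monte Carlo complexity theorem when
the variance decays faster than the cost grows. -/
lemma exists_multilevel_allocation {A B κ β : ℝ} (hA : 0 < A) (hB : 0 < B) (hκ : 0 ≤ κ)
    (hβ : 1 < β) :
    ∃ c : ℝ, 0 < c ∧ ∀ ε : ℝ, 0 < ε → ε < 1 → ∃ (L : ℕ) (N : ℕ → ℕ), (∀ ℓ, 0 < N ℓ) ∧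
      ∑ ℓ ∈ Finset.range (L + 1), A * (2 : ℝ) ^ (-β * (ℓ : ℝ)) / N ℓ + B * (1 / 2) ^ L ≤ ε ^ 2 ∧
      ∑ ℓ ∈ Finset.range (L + 1), N ℓ * (κ * (2 : ℝ) ^ ℓ) ≤ c * ε ^ (-2 : ℝ) := by
  set r : ℝ := (2 : ℝ) ^ (-((β - 1) / 2)) with hr
  have hr0 : 0 < r := by positivity
  have hr1 : r < 1 := Real.rpow_lt_one_of_one_lt_of_neg (by norm_num) (by linarith)
  set S : ℝ := (1 - r)⁻¹ with hS
  have hS0 : 0 < S := inv_pos.2 (by linarith)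
  have hgeom : ∀ L : ℕ, ∑ ℓ ∈ Finset.range (L + 1), r ^ ℓ ≤ S := fun L => by
    rw [hS, ← tsum_geometric_of_lt_one hr0.le hr1]
    exact (summable_geometric_of_lt_one hr0.le hr1).sum_le_tsum _ fun _ _ => by positivity
  set K : ℝ := 2 * A * S with hK
  have hK0 : 0 < K := by positivity
  -- With sample numbers proportional to (r/2)^ℓ, the variance per level and the cost per level are
  -- both proportional to r^ℓ. These are the usual numbers proportional to the square root of
  -- variance over cost.
  have hdecay : ∀ ℓ : ℕ, (2 : ℝ) ^ (-β * (ℓ : ℝ)) = (r / 2) ^ ℓ * r ^ ℓ := fun ℓ => by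
    have h1 : (2 : ℝ) ^ (-β) = r / 2 * r := by
      have h2 : r * r = (2 : ℝ) ^ (-(β - 1)) := by
        rw [hr, ← Real.rpow_add (by norm_num)]; ring_nf
      have h3 : (2 : ℝ) ^ (-(β - 1)) = 2 ^ (-β) * 2 := by
        nth_rewrite 3 [← Real.rpow_one (2 : ℝ)]
        rw [← Real.rpow_add (by norm_num)]; ring_nf
      linarith
    rw [← mul_pow, ← h1, Real.rpow_mul (by norm_num), Real.rpow_natCast]
  -- The final 1 keeps the constant positive when κ = 0.
  refine ⟨κ * (8 * (B + 1) + K * S) + 1, by positivity, fun ε hε hε1 => ?_⟩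
  have hε2 : 0 < ε ^ 2 := by positivity
  have hε21 : ε ^ 2 < 1 := by nlinarith
  have hεr : ε ^ (-2 : ℝ) = (ε ^ 2)⁻¹ := by
    rw [Real.rpow_neg hε.le]; norm_num
  -- L = n + 1 gives 2^L > 2(B+1) / ε^2, so the squared bias takes at most half of ε^2, while 2^n ≤
  -- 2(B+1) / ε^2 bounds the cost. Using B + 1 keeps the argument above 1, as the choice of n
  -- requires.
  obtain ⟨n, hn1, hn2⟩ := exists_nat_pow_near (x := 2 * (B + 1) / ε ^ 2) (y := 2)
    (by rw [le_div_iff₀ hε2]; nlinarith) (by norm_num)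
  refine ⟨n + 1, fun ℓ => ⌈K * (ε ^ 2)⁻¹ * (r / 2) ^ ℓ⌉₊, fun ℓ => Nat.ceil_pos.2 (by positivity),
    ?_, ?_⟩
  · have h1 : ∀ ℓ : ℕ, A * (2 : ℝ) ^ (-β * (ℓ : ℝ)) / (⌈K * (ε ^ 2)⁻¹ * (r / 2) ^ ℓ⌉₊ : ℝ)
        ≤ ε ^ 2 / (2 * S) * r ^ ℓ := fun ℓ => by
      have hle := Nat.le_ceil (K * (ε ^ 2)⁻¹ * (r / 2) ^ ℓ)
      have hpos : 0 < K * (ε ^ 2)⁻¹ * (r / 2) ^ ℓ := by positivity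
      rw [div_le_iff₀ (hpos.trans_le hle), hdecay]
      refine le_trans (le_of_eq ?_) (mul_le_mul_of_nonneg_left hle (by positivity))
      rw [hK]
      field_simp
    have h2 := (Finset.sum_le_sum fun ℓ (_ : ℓ ∈ Finset.range (n + 1 + 1)) => h1 ℓ)
    rw [← Finset.mul_sum] at h2
    have h3 := mul_le_mul_of_nonneg_left (hgeom (n + 1)) (by positivity : 0 ≤ ε ^ 2 / (2 * S))
    have h4 : ε ^ 2 / (2 * S) * S = ε ^ 2 / 2 := by field_simp
    have h5 : B * (1 / 2) ^ (n + 1) ≤ ε ^ 2 / 2 := by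
      rw [div_lt_iff₀ hε2] at hn2
      rw [one_div, inv_pow, ← div_eq_mul_inv, div_le_iff₀ (by positivity)]
      linarith
    linarith
  -- Rounding up adds at most one sample per level. These extra samples cost O(2^L), which is still
  -- O(ε^(-2)).
  · have h1 : ∀ ℓ : ℕ, (⌈K * (ε ^ 2)⁻¹ * (r / 2) ^ ℓ⌉₊ : ℝ) * (κ * (2 : ℝ) ^ ℓ)
        ≤ κ * (2 ^ ℓ + K * (ε ^ 2)⁻¹ * r ^ ℓ) := fun ℓ => by
      have hle := (Nat.ceil_lt_add_one (by positivity : 0 ≤ K * (ε ^ 2)⁻¹ * (r / 2) ^ ℓ)).le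
      refine (mul_le_mul_of_nonneg_right hle (by positivity)).trans (le_of_eq ?_)
      rw [div_pow]
      field_simp
      ring
    refine (Finset.sum_le_sum fun ℓ (_ : ℓ ∈ Finset.range (n + 1 + 1)) => h1 ℓ).trans ?_
    rw [← Finset.mul_sum, Finset.sum_add_distrib, ← Finset.mul_sum, geom_sum_eq (by norm_num), hεr]
    have h3 := mul_le_mul_of_nonneg_left (hgeom (n + 1)) (by positivity : 0 ≤ K * (ε ^ 2)⁻¹)
    have h4 : ((2 : ℝ) ^ (n + 1 + 1) - 1) / (2 - 1) ≤ 8 * (B + 1) * (ε ^ 2)⁻¹ := by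
      rw [div_eq_mul_inv] at hn1
      have : (2 : ℝ) ^ (n + 1 + 1) = 4 * 2 ^ n := by ring
      rw [this]
      norm_num
      linarith
    have h5 := mul_le_mul_of_nonneg_left (add_le_add h4 h3) hκ
    have h6 : 0 ≤ (ε ^ 2)⁻¹ := by positivity
    linarith

lemma integral_sub_const_sq_eq {Ω : Type*} [MeasurableSpace Ω] {μ : Measure Ω}
    [IsProbabilityMeasure μ] {Z : Ω → ℝ} (hZ : MemLp Z 2 μ) (c : ℝ) :
    ∫ ω, (Z ω - c) ^ 2 ∂μ = variance Z μ + (∫ ω, Z ω ∂μ - c) ^ 2 := by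
  have h1 : Integrable Z μ := hZ.integrable (by norm_num)
  have h2 : Integrable (fun ω => Z ω ^ 2) μ := hZ.integrable_sq
  have e : ∀ ω, (Z ω - c) ^ 2 = Z ω ^ 2 - 2 * c * Z ω + c ^ 2 := fun ω => by ring
  simp only [e]
  have h3 : Integrable (fun ω => Z ω ^ 2 - 2 * c * Z ω) μ := h2.sub (h1.const_mul _)
  rw [integral_add h3 (integrable_const _),
    integral_sub h2 (h1.const_mul _), integral_const_mul, integral_const, probReal_univ, one_smul,
    variance_eq_sub hZ]
  simp only [Pi.pow_apply]
  ring

namespace DecisionModel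

section Multilevel

variable {D Θ E : Type*} [MeasurableSpace Θ] [MeasurableSpace E] (M : DecisionModel D Θ E)
variable {Ω : Type*} {X : ℕ → ℕ → Ω → E × (ℕ → Θ)}

/-- A single sum over pairs (level, sample) lets the variance be added up by pairwise independence
in one step. -/
lemma mlmc_eq_sum_sigma [Fintype D] [Nonempty D] (M₀ L : ℕ) (N : ℕ → ℕ) :
    M.mlmc M₀ X L N = ∑ k ∈ (Finset.range (L + 1)).sigma fun ℓ => Finset.range (N ℓ),
      fun ω => M.deltaP M₀ k.1 (X k.1 k.2 ω) / N k.1 := by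
  ext ω
  rw [Finset.sum_apply, Finset.sum_sigma]
  simp only [mlmc, Finset.sum_div]

lemma mlmcCost_le (D : Type*) [Fintype D] (costY costθ costLik costF : NNReal) {M₀ : ℕ}
    (hM₀ : 0 < M₀) (L : ℕ) (N : ℕ → ℕ) :
    mlmcCost D costY costθ costLik costF M₀ L N ≤ ∑ ℓ ∈ Finset.range (L + 1),
      N ℓ * ((M₀ * (costY + (costθ + costLik + Fintype.card D * costF)) : ℝ) * (2 : ℝ) ^ ℓ) := by
  refine Finset.sum_le_sum fun ℓ _ => mul_le_mul_of_nonneg_left ?_ (Nat.cast_nonneg _)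
  have h1 : (1 : ℝ) ≤ 2 ^ ℓ := one_le_pow₀ (by norm_num)
  have h0 : (1 : ℝ) ≤ M₀ := by exact_mod_cast hM₀
  have h2 : (costY : ℝ) * 1 ≤ costY * (M₀ * 2 ^ ℓ) :=
    mul_le_mul_of_nonneg_left (one_le_mul_of_one_le_of_one_le h0 h1) costY.coe_nonneg
  unfold sampleCost
  push_cast
  linarith

variable [MeasurableSpace Ω] {μ : Measure Ω}

lemma IsSampling.integral_comp {M : DecisionModel D Θ E} (hX : M.IsSampling μ X)
    {g : E × (ℕ → Θ) → ℝ} (hg : Measurable g) (ℓ n : ℕ) :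
    ∫ ω, g (X ℓ n ω) ∂μ = ∫ x, g x ∂M.sampleLaw := by
  have h := integral_map (hX.meas ℓ n).aemeasurable hg.aestronglyMeasurable (μ := μ)
  rw [hX.law ℓ n] at h
  exact h.symm

variable [Fintype D] [Nonempty D]

lemma memLp_deltaP_comp [IsProbabilityMeasure μ] (hbdd : M.BoundedBenefit)
    (hX : M.IsSampling μ X) (M₀ ℓ n : ℕ) : MemLp (fun ω => M.deltaP M₀ ℓ (X ℓ n ω)) 2 μ := by
  obtain ⟨F, hF0, hF⟩ := hbdd
  exact MemLp.of_bound ((M.measurable_deltaP M₀ ℓ).comp (hX.meas ℓ n)).aestronglyMeasurable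
    (4 * F) (ae_of_all _ fun ω => M.abs_deltaP_le hF0.le hF M₀ ℓ _)

lemma variance_deltaP_comp_le [IsProbabilityMeasure μ] (hX : M.IsSampling μ X) (M₀ ℓ n : ℕ) :
    variance (fun ω => M.deltaP M₀ ℓ (X ℓ n ω)) μ
      ≤ ∫ x, |M.deltaP M₀ ℓ x| ^ (2 : ℝ) ∂M.sampleLaw := by
  have hm := M.measurable_deltaP M₀ ℓ
  refine (variance_le_expectation_sq (hm.comp (hX.meas ℓ n)).aestronglyMeasurable).trans
    (le_of_eq ?_)
  rw [← hX.integral_comp (by fun_prop) ℓ n]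
  refine integral_congr_ae (ae_of_all _ fun ω => ?_)
  simp

lemma memLp_mlmc [IsProbabilityMeasure μ] (hbdd : M.BoundedBenefit) (hX : M.IsSampling μ X)
    (M₀ L : ℕ) (N : ℕ → ℕ) : MemLp (M.mlmc M₀ X L N) 2 μ := by
  rw [mlmc_eq_sum_sigma]
  exact memLp_finsetSum' _ fun k _ => by
    simpa only [div_eq_mul_inv] using (M.memLp_deltaP_comp hbdd hX M₀ k.1 k.2).mul_const _

lemma integral_mlmc [IsProbabilityMeasure μ] (hbdd : M.BoundedBenefit) (hX : M.IsSampling μ X)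
    (M₀ L : ℕ) {N : ℕ → ℕ} (hN : ∀ ℓ, 0 < N ℓ) :
    ∫ ω, M.mlmc M₀ X L N ω ∂μ = ∫ x, M.ratioEst 0 (M₀ * 2 ^ L) x ∂M.sampleLaw := by
  have hI : ∀ ℓ n, Integrable (fun ω => M.deltaP M₀ ℓ (X ℓ n ω)) μ := fun ℓ n =>
    (M.memLp_deltaP_comp hbdd hX M₀ ℓ n).integrable (by norm_num)
  rw [← M.sum_integral_deltaP hbdd]
  unfold mlmc
  rw [integral_finsetSum _ fun ℓ _ => (integrable_finsetSum _ fun n _ => hI ℓ n).div_const _]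
  refine Finset.sum_congr rfl fun ℓ _ => ?_
  rw [integral_div, integral_finsetSum _ fun n _ => hI ℓ n]
  simp only [hX.integral_comp (M.measurable_deltaP M₀ ℓ), Finset.sum_const, Finset.card_range,
    nsmul_eq_mul]
  have : (N ℓ : ℝ) ≠ 0 := by exact_mod_cast (hN ℓ).ne'
  field_simp

lemma variance_mlmc_le [IsProbabilityMeasure μ] (hbdd : M.BoundedBenefit) (hX : M.IsSampling μ X)
    (M₀ L : ℕ) {N : ℕ → ℕ} (hN : ∀ ℓ, 0 < N ℓ) :
    variance (M.mlmc M₀ X L N) μ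
      ≤ ∑ ℓ ∈ Finset.range (L + 1), (∫ x, |M.deltaP M₀ ℓ x| ^ (2 : ℝ) ∂M.sampleLaw) / N ℓ := by
  rw [mlmc_eq_sum_sigma, IndepFun.variance_sum]
  · rw [Finset.sum_sigma]
    refine Finset.sum_le_sum fun ℓ _ => ?_
    have hN0 : (0 : ℝ) < N ℓ := by exact_mod_cast hN ℓ
    have h1 : ∀ n, variance (fun ω => M.deltaP M₀ ℓ (X ℓ n ω) / N ℓ) μ
        ≤ ((N ℓ : ℝ)⁻¹) ^ 2 * ∫ x, |M.deltaP M₀ ℓ x| ^ (2 : ℝ) ∂M.sampleLaw := fun n => by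
      have h2 := variance_const_mul ((N ℓ : ℝ)⁻¹) (fun ω => M.deltaP M₀ ℓ (X ℓ n ω)) μ
      simp only [div_eq_inv_mul]
      rw [h2]
      exact mul_le_mul_of_nonneg_left (M.variance_deltaP_comp_le hX M₀ ℓ n) (by positivity)
    refine (Finset.sum_le_sum fun n _ => h1 n).trans (le_of_eq ?_)
    rw [Finset.sum_const, Finset.card_range, nsmul_eq_mul]
    field_simp
  · intro k _
    simpa only [div_eq_mul_inv] using (M.memLp_deltaP_comp hbdd hX M₀ k.1 k.2).mul_const _
  · rintro ⟨ℓ, n⟩ - ⟨ℓ', n'⟩ - hne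
    have hne' : ((ℓ, n) : ℕ × ℕ) ≠ (ℓ', n') := by
      rintro h
      obtain ⟨rfl, rfl⟩ := Prod.mk.inj h
      exact hne rfl
    exact (hX.indep.indepFun hne').comp ((M.measurable_deltaP M₀ ℓ).div_const (N ℓ : ℝ))
      ((M.measurable_deltaP M₀ ℓ').div_const (N ℓ' : ℝ))

theorem exists_mlmc_mse_le [PseudoEMetricSpace E] [OpensMeasurableSpace E]
    [IsProbabilityMeasure μ] {p : ℝ} (hp : 2 < p) (hbdd : M.BoundedBenefit)
    (hK : M.ManifoldProbBound) (hsep : M.LinearSeparation) (hmom : M.LikelihoodRatioMoment p)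
    {M₀ : ℕ} (hM₀ : 0 < M₀) (hX : M.IsSampling μ X) (costY costθ costLik costF : NNReal) :
    ∃ c : ℝ, 0 < c ∧ ∀ ε : ℝ, 0 < ε → ε < 1 → ∃ (L : ℕ) (N : ℕ → ℕ), (∀ ℓ, 0 < N ℓ) ∧
      ∫ ω, (M.mlmc M₀ X L N ω - (M.EVPI - M.EVSI)) ^ 2 ∂μ ≤ ε ^ 2 ∧
      mlmcCost D costY costθ costLik costF M₀ L N ≤ c * ε ^ (-2 : ℝ) := by
  obtain ⟨A, hA, HA⟩ := M.exists_integral_abs_deltaP_rpow_le hp.le one_le_two le_rfl hbdd hK hsep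
    hmom hM₀
  obtain ⟨B, hB, HB⟩ := M.exists_abs_integral_ratioEst_sub_le hp.le hbdd hmom
  -- This is equivalent to p > 2.
  have hβ : 1 < p / (2 * p + 2) * (2 + 1) := by
    rw [div_mul_eq_mul_div, lt_div_iff₀ (by linarith)]
    linarith
  -- The allocation is stated for the squared bias, hence B^2 and the rate (2^(-L/2))^2 = 2^(-L).
  obtain ⟨c, hc, H⟩ := exists_multilevel_allocation hA (pow_pos hB 2)
    (by positivity : (0 : ℝ) ≤ M₀ * (costY + (costθ + costLik + Fintype.card D * costF))) hβ
  refine ⟨c, hc, fun ε hε hε1 => ?_⟩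
  obtain ⟨L, N, hN, hmse, hcost⟩ := H ε hε hε1
  refine ⟨L, N, hN, ?_, (mlmcCost_le D costY costθ costLik costF hM₀ L N).trans hcost⟩
  rw [integral_sub_const_sq_eq (M.memLp_mlmc hbdd hX M₀ L N)]
  refine le_trans (add_le_add ?_ ?_) hmse
  · refine (M.variance_mlmc_le hbdd hX M₀ L hN).trans (Finset.sum_le_sum fun ℓ _ => ?_)
    exact div_le_div_of_nonneg_right (HA ℓ) (Nat.cast_nonneg _)
  · rw [M.integral_mlmc hbdd hX M₀ L hN]
    have h1 := HB (M₀ * 2 ^ L) (by positivity)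
    have h2 : ((M₀ * 2 ^ L : ℕ) : ℝ) ^ (-(1 / 2 : ℝ)) ≤ ((2 : ℝ) ^ L) ^ (-(1 / 2 : ℝ)) := by
      refine Real.rpow_le_rpow_of_nonpos (by positivity) ?_ (by norm_num)
      push_cast
      exact le_mul_of_one_le_left (by positivity) (by exact_mod_cast hM₀)
    have h3 := h1.trans (mul_le_mul_of_nonneg_left h2 hB.le)
    rw [← sq_abs]
    refine (pow_le_pow_left₀ (abs_nonneg _) h3 2).trans (le_of_eq ?_)
    rw [mul_pow, ← Real.rpow_natCast (((2 : ℝ) ^ L) ^ (-(1 / 2 : ℝ))) 2,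
      ← Real.rpow_mul (by positivity)]
    rw [one_div, inv_pow, ← Real.rpow_neg_one ((2 : ℝ) ^ L)]
    norm_num

end Multilevel

end DecisionModel

/-! ### The theorem: moments q = 2 and q = 1, and the complexity bound. -/

theorem theorem2 {D Θ E Ω : Type*} [Fintype D] [Nonempty D] [MeasurableSpace Θ]
    [NormedAddCommGroup E] [NormedSpace ℝ E] [MeasurableSpace E] [BorelSpace E]
    (M : DecisionModel D Θ E)
    (hbdd : M.BoundedBenefit) (hK : M.ManifoldProbBound) (hsep : M.LinearSeparation)
    (p : ℝ) (hp : 2 ≤ p) (hmom : M.LikelihoodRatioMoment p)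
    (M₀ : ℕ) (hM₀ : 0 < M₀)
    [MeasurableSpace Ω] (μ : Measure Ω) [IsProbabilityMeasure μ]
    (X : ℕ → ℕ → Ω → E × (ℕ → Θ)) (hX : M.IsSampling μ X) :
    (∀ ℓ n, MemLp (fun ω => M.deltaP M₀ ℓ (X ℓ n ω)) 2 μ) ∧
    (∀ n, (fun ℓ : ℕ => variance (fun ω => M.deltaP M₀ ℓ (X ℓ n ω)) μ)
      =O[atTop] fun ℓ : ℕ => (2 : ℝ) ^ (-(3 * p / (2 * p + 2)) * (ℓ : ℝ))) ∧
    (∀ n, (fun ℓ : ℕ => ∫ ω, |M.deltaP M₀ ℓ (X ℓ n ω)| ∂μ)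
      =O[atTop] fun ℓ : ℕ => (2 : ℝ) ^ (-(p / (p + 1)) * (ℓ : ℝ))) ∧
    (2 < p → ∀ costY costθ costLik costF : NNReal,
      ∃ c₄ : ℝ, 0 < c₄ ∧ ∀ ε : ℝ, 0 < ε → ε < Real.exp (-1) →
        ∃ (L : ℕ) (N : ℕ → ℕ), (∀ ℓ ≤ L, 0 < N ℓ) ∧
          MemLp (M.mlmc M₀ X L N) 2 μ ∧
          ∫ ω, (M.mlmc M₀ X L N ω - (M.EVPI - M.EVSI)) ^ 2 ∂μ ≤ ε ^ 2 ∧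
          DecisionModel.mlmcCost D costY costθ costLik costF M₀ L N ≤ c₄ * ε ^ (-2 : ℝ)) := by
  have hp1 : (0 : ℝ) < 2 * p + 2 := by linarith
  refine ⟨fun ℓ n => M.memLp_deltaP_comp hbdd hX M₀ ℓ n, fun n => ?_, fun n => ?_, ?_⟩
  · obtain ⟨C, -, H⟩ := M.exists_integral_abs_deltaP_rpow_le hp one_le_two le_rfl hbdd hK hsep
      hmom hM₀
    refine IsBigO.of_bound C (Eventually.of_forall fun ℓ => ?_)
    rw [Real.norm_of_nonneg (variance_nonneg _ _), Real.norm_of_nonneg (by positivity)]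
    refine (M.variance_deltaP_comp_le hX M₀ ℓ n).trans ((H ℓ).trans_eq ?_)
    congr 3
    field_simp
    ring
  · obtain ⟨C, -, H⟩ := M.exists_integral_abs_deltaP_rpow_le hp le_rfl one_le_two hbdd hK hsep
      hmom hM₀
    refine IsBigO.of_bound C (Eventually.of_forall fun ℓ => ?_)
    rw [Real.norm_of_nonneg (integral_nonneg fun ω => abs_nonneg _),
      Real.norm_of_nonneg (by positivity)]
    have hm := M.measurable_deltaP M₀ ℓ
    rw [hX.integral_comp (g := fun x => |M.deltaP M₀ ℓ x|) (by fun_prop) ℓ n]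
    have h := H ℓ
    simp only [Real.rpow_one] at h
    refine h.trans_eq ?_
    congr 3
    field_simp
    ring
  · intro hp2 costY costθ costLik costF
    obtain ⟨c, hc, H⟩ := M.exists_mlmc_mse_le hp2 hbdd hK hsep hmom hM₀ hX costY costθ costLik costF
    refine ⟨c, hc, fun ε hε hε1 => ?_⟩
    obtain ⟨L, N, hN, hmse, hcost⟩ := H ε hε (hε1.trans (Real.exp_zero ▸ Real.exp_lt_exp.2 (by norm_num)))
    exact ⟨L, N, fun ℓ _ => hN ℓ, M.memLp_mlmc hbdd hX M₀ L N, hmse, hcost⟩
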